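/- **Model.** Fix a maximal query length $N$. Let $d,m\ge 1$, mixture parameters $\alpha_i\in(1/2,1]$ and spread parameters $\beta_i$ with $|\beta_i|\le B$ for $1\le i\le N$, a Poisson rate $\lambda>0$ and an adjacency radius $\epsilon_p>0$. The trigram vectors are $T=(t_1,\dots,t_m)$ with $t_j=s_jg_j$, where $g_1,\dots,g_m$ are independent standard Gaussian vectors in $\mathbb R^d$ and the scalars satisfy $|s_j|\le S$. A product $p$ is uniform on the unit sphere of $\mathbb R^d$. Given $p$, a query $q=(t_1,\dots,t_{n(q)})$ is generated by drawing its length $n(q)$ from the Poisson($\lambda$) distribution truncated to $\{0,\dots,N\}$, and then, independently over positions $i$, the $i$-th trigram from $$P_{p,i}(t)=\alpha_i\frac{\exp(\beta_i\langle t,p\rangle)}{Z_{p,i}}+(1-\alpha_i)\frac1m,\qquad Z_{p,i}=\sum_{t\in T}\exp(\beta_i\langle t,p\rangle).$$ Let $\Pr[q]=\mathbb E_p[\Pr[q\mid p]]$, and let $\Pr[q,q']=\mathbb E\big[\Pr[q\mid p]\Pr[q'\mid p']\,\big|\,\|p-p'\|\le\epsilon_p\big]$, with $p,p'$ independent and uniform,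 be the probability that $q,q'$ co-occur as the endpoints of an edge of the query graph. Let $\mathrm{PMI}(q,q')=\log\frac{\Pr[q,q']}{\Pr[q]\Pr[q']}$. Identify $q$ with its vector $\sum_{i\le n(q)}\beta_it_i\in\mathbb R^d$. Write $\ell(n)$ for the probability of length $n$ and $Z_i=\sum_j\exp(\beta_i^2s_j^2/2)$. **Statement.** For all $N,B,S$ there are $C,c>0$ and $k\in\mathbb N$, depending only on $N,B,S$, such that for all $d,m,\alpha,\beta,\lambda,\epsilon_p,s$ as above the following holds. Put $$\epsilon''=C\Big(\frac{(\log m)^k}{\sqrt m}+\frac1d+\max_i(1-\alpha_i)\Big),\qquad \epsilon'=\epsilon''+C\epsilon_p .$$ The matrix $\big(\langle q,q'\rangle/d\big)_{q,q'}$ always has rank at most $d$. For every set $L$ of trigram labels, with probability at least $1-C\big(e^{-c\log^2m}+|L|e^{-d}\big)$ over the Gaussian vectors, simultaneously for all queries $q,q'$ (of length at most $N$) with trigrams in $L$: $\Pr[q]$ and $\Pr[q,q']$ are positive, $$\Pr[q,q']=(1\pm\epsilon')\,\ell(n(q))\,\ell(n(q'))\prod_{i\le n(q)}\frac{\alpha_i}{Z_i}\prod_{j\le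 n(q')}\frac{\alpha_j}{Z_j}\exp\Big(\frac{\|q+q'\|^2}{2d}\Big),$$ $$\Pr[q]=(1\pm\epsilon'')\,\ell(n(q))\prod_{i\le n(q)}\frac{\alpha_i}{Z_i}\exp\Big(\frac{\|q\|^2}{2d}\Big),$$ and $$\Big|\mathrm{PMI}(q,q')-\frac{\langle q,q'\rangle}{d}\Big|\le C(\epsilon'+\epsilon'').$$ In particular the PMI matrix of these queries is entrywise within $O(\epsilon'+\epsilon'')$ of a matrix of rank at most $d$. -/

import Mathlib

open MeasureTheory

namespace AttEST

noncomputable section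

/-- The ambient latent space `ℝ^d` with its Euclidean norm. -/
abbrev Vec (d : ℕ) : Type := EuclideanSpace ℝ (Fin d)

/-- The space of product vectors: the unit sphere of `ℝ^d`. -/
abbrev Product (d : ℕ) : Type := Metric.sphere (0 : Vec d) 1

/-- The uniform probability measure on the unit sphere of `ℝ^d` (normalized surface measure). -/
def productLaw (d : ℕ) : Measure (Product d) :=
  ProbabilityTheory.cond (volume : Measure (Vec d)).toSphere Set.univ

/-- The law of a pair of independent uniform products, conditioned on being at distance at most
`ε`, i.e. on the event that queries generated by them are adjacent in the query graph. -/
def adjacentProductLaw (d : ℕ) (ε : ℝ) : Measure (Product d × Product d) :=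
  ProbabilityTheory.cond ((productLaw d).prod (productLaw d))
    {x | ‖(x.1 : Vec d) - (x.2 : Vec d)‖ ≤ ε}

/-- The numerical parameters of the model with maximal query length `N`. -/
structure Params (N : ℕ) where
  /-- mixture parameter of each position -/
  α : Fin N → ℝ
  /-- spread parameter of each position -/
  β : Fin N → ℝ
  /-- rate of the Poisson distribution of the query length -/
  rate : ℝ
  /-- two queries are adjacent when their products are at distance at most `radius` -/
  radius : ℝ
  half_lt_α : ∀ i, 1 / 2 < α i
  α_le_one : ∀ i, α i ≤ 1
  rate_pos : 0 < rate
  radius_pos : 0 < radius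

/-- A query: a length `n ≤ N` and a sequence of `n` trigrams out of a vocabulary of `m`. -/
abbrev Query (N m : ℕ) : Type := Σ n : Fin (N + 1), (Fin (n : ℕ) → Fin m)

/-- The `i`-th place of a query, as one of the `N` positions. -/
def position {N m : ℕ} (q : Query N m) (i : Fin (q.1 : ℕ)) : Fin N :=
  Fin.castLE (Nat.lt_succ_iff.mp q.1.isLt) i

variable {N m d : ℕ}

/-- The Poisson distribution truncated to `{0, …, N}` (conditioned on the value being `≤ N`). -/
def lengthProb (P : Params N) (n : ℕ) : ℝ :=
  (P.rate ^ n / (n.factorial : ℝ)) /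
    ∑ k ∈ Finset.range (N + 1), P.rate ^ k / (k.factorial : ℝ)

/-- The partition function `Z_{p,i}`. -/
def partition (P : Params N) (T : Fin m → Vec d) (p : Product d) (i : Fin N) : ℝ :=
  ∑ t, Real.exp (P.β i * inner ℝ (T t) (p : Vec d))

/-- The mixture distribution `P_{p,i}` of the trigram at position `i`, given the product `p`. -/
def trigramProb (P : Params N) (T : Fin m → Vec d) (p : Product d) (i : Fin N) (t : Fin m) : ℝ :=
  P.α i * (Real.exp (P.β i * inner ℝ (T t) (p : Vec d)) / partition P T p i)
    + (1 - P.α i) * (1 / (m : ℝ))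

/-- The probability that the product `p` generates the query `q`: the length is drawn first, then
the trigrams independently. -/
def queryProbGiven (P : Params N) (T : Fin m → Vec d) (p : Product d) (q : Query N m) : ℝ :=
  lengthProb P q.1 * ∏ i, trigramProb P T p (position q i) (q.2 i)

/-- `Pr[q]`: the probability that a random product generates `q`. -/
def queryProb (P : Params N) (T : Fin m → Vec d) (q : Query N m) : ℝ :=
  ∫ p, queryProbGiven P T p q ∂(productLaw d)

/-- `Pr[q, q']`: the probability of `q, q'` co-occurring as endpoints of an edge, that is, of
being generated (independently, given the products) by a random pair of adjacent products. -/
def cooccurProb (P : Params N) (T : Fin m → Vec d) (q q' : Query N m) : ℝ :=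
  ∫ x, queryProbGiven P T x.1 q * queryProbGiven P T x.2 q' ∂(adjacentProductLaw d P.radius)

/-- The pointwise mutual information of two queries. -/
def pmi (P : Params N) (T : Fin m → Vec d) (q q' : Query N m) : ℝ :=
  Real.log (cooccurProb P T q q' / (queryProb P T q * queryProb P T q'))

/-- The vector `∑ i, β_i t_i` of a query. -/
def queryVec (P : Params N) (T : Fin m → Vec d) (q : Query N m) : Vec d :=
  ∑ i, P.β (position q i) • T (q.2 i)

/-- The matrix of the scaled inner products `⟨q, q'⟩ / d`. -/
def gramMatrix (P : Params N) (T : Fin m → Vec d) : Matrix (Query N m) (Query N m) ℝ :=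
  Matrix.of fun q q' => inner ℝ (queryVec P T q) (queryVec P T q') / (d : ℝ)

/-- The constant `Z_i` around which the partition functions concentrate when the `t`-th trigram
is `s t` times a standard Gaussian: the expectation of `Z_{p,i}`, for any unit vector `p`. -/
def meanPartition (P : Params N) (s : Fin m → ℝ) (i : Fin N) : ℝ :=
  ∑ t, Real.exp ((P.β i * s t) ^ 2 / 2)

/-- The closed form approximating `Pr[q]`. -/
def queryProbApprox (P : Params N) (s : Fin m → ℝ) (T : Fin m → Vec d) (q : Query N m) : ℝ :=
  lengthProb P q.1 * (∏ i, P.α (position q i) / meanPartition P s (position q i))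
    * Real.exp (‖queryVec P T q‖ ^ 2 / (2 * (d : ℝ)))

/-- The closed form approximating `Pr[q, q']`. -/
def cooccurProbApprox (P : Params N) (s : Fin m → ℝ) (T : Fin m → Vec d) (q q' : Query N m) : ℝ :=
  (lengthProb P q.1 * ∏ i, P.α (position q i) / meanPartition P s (position q i))
    * (lengthProb P q'.1 * ∏ j, P.α (position q' j) / meanPartition P s (position q' j))
    * Real.exp (‖queryVec P T q + queryVec P T q'‖ ^ 2 / (2 * (d : ℝ)))

/-- The order of `ε''`: `(log m)^k / √m` from the partition functions, `1 / d` from averaging over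
the sphere, and the largest weight of the uniform noise component of the mixtures. -/
def singleError (P : Params N) (k m d : ℕ) : ℝ :=
  Real.log (m : ℝ) ^ k / √(m : ℝ) + 1 / (d : ℝ) + ⨆ i, (1 - P.α i)

/-- The order of `ε'`: as for a single query, plus the distance allowed between the products. -/
def jointError (P : Params N) (k m d : ℕ) : ℝ :=
  singleError P k m d + P.radius

/-- The law of `m` independent standard Gaussian vectors in `ℝ^d`. -/
def gaussianLaw (m d : ℕ) : Measure (Fin m → Vec d) :=
  Measure.pi fun _ => ProbabilityTheory.stdGaussian (Vec d)

end

end AttEST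

/-! Given a product, a query has as probability a product of mixture weights. Two things have to be
done: replace the random normalisers $Z_{p,i}$ by the constants $Z_i$, and average the exponential
of a linear form over the sphere.

Normalisers. For a fixed product, $Z_{p,i}$ is a sum of $m$ independent lognormal variables with
mean $Z_i\ge m$. Truncation and a Chernoff bound give a deviation $O(\sqrt m\log m)$ outside an
event of probability $e^{-c\log^2 m}$ (`measureReal_abs_partition_sub_le`). No uniformity over the
sphere is needed, hence no relation between $d$ and $m$: by Fubini and Markov, most vocabularies
leave only a fraction $e^{-c\log^2m}$ of atypical products (`gaussianLaw_exceptionalMass_le`). Those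
contribute an additive error which is negligible because the weights $\prod\alpha_i/Z_i$ are at
least polynomially small in $m$ (`one_le_prod_mul_pow`). The uniform noise costs a relative error
$\max_i(1-\alpha_i)$.

Sphere average. The moments of a coordinate satisfy an explicit recursion, so $\mathbb E\,e^{\langle
v,p\rangle}$ is the series of $e^{\|v\|^2/2d}$ with coefficients damped by $1-O(k^2/d)$
(`hasSum_integral_exp_inner`); when $\|v\|^2=O(d)$ this costs $O(1/d)$. Query vectors have such
norms once the Gaussian vectors with labels in $L$ do, which fails with probability at most
$|L|e^{-d}$.

Pairs. The adjacent pair law is invariant under rotations and has uniform marginals. Hence $\mathbb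
E\langle w,p'-p\rangle^2\le\|w\|^2\epsilon_p^2/d$, and replacing $p'$ by $p$ costs only
$O(\epsilon_p)$ (`abs_integral_exp_adjacent_sub_le`).

PMI. Expanding $\|q+q'\|^2$, all factors cancel except $e^{\langle q,q'\rangle/d}$. The logarithm is
controlled for errors of any size because each true probability is at least a fixed fraction
$\kappa$ of its closed form. -/

namespace AttEST

noncomputable section

/-! ### Rotation invariance of the uniform law and of the law of adjacent pairs. -/

section

variable {d : ℕ}

/-- The action of a linear isometry on the unit sphere. -/
def sphereMap (L : Vec d ≃ₗᵢ[ℝ] Vec d) (p : Product d) : Product d :=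
  ⟨L p, by simp⟩

@[simp] lemma coe_sphereMap (L : Vec d ≃ₗᵢ[ℝ] Vec d) (p : Product d) :
    (sphereMap L p : Vec d) = L p := rfl

lemma continuous_sphereMap (L : Vec d ≃ₗᵢ[ℝ] Vec d) : Continuous (sphereMap L) :=
  (L.continuous.comp continuous_subtype_val).subtype_mk _

-- The surface measure of a set is proportional to the volume of the cone over it; an isometry
-- carries cones to cones and preserves volume.
open scoped Pointwise in
lemma measurePreserving_sphereMap_toSphere (L : Vec d ≃ₗᵢ[ℝ] Vec d) :
    MeasurePreserving (sphereMap L) (volume : Measure (Vec d)).toSphere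
      (volume : Measure (Vec d)).toSphere := by
  refine ⟨(continuous_sphereMap L).measurable, ?_⟩
  ext s hs
  rw [Measure.map_apply (continuous_sphereMap L).measurable hs, Measure.toSphere_apply' _ hs,
    Measure.toSphere_apply' _ ((continuous_sphereMap L).measurable hs)]
  congr 1
  have hset : (Set.Ioo (0 : ℝ) 1 • (Subtype.val '' (sphereMap L ⁻¹' s)) : Set (Vec d))
      = L ⁻¹' (Set.Ioo (0 : ℝ) 1 • (Subtype.val '' s)) := by
    ext x
    simp only [Set.mem_smul, Set.mem_image, Set.mem_preimage]
    constructor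
    · rintro ⟨r, hr, y, ⟨p, hp, rfl⟩, rfl⟩
      exact ⟨r, hr, L p, ⟨_, hp, rfl⟩, by simp⟩
    · rintro ⟨r, hr, y, ⟨p, hp, rfl⟩, h⟩
      refine ⟨r, hr, L.symm p, ⟨sphereMap L.symm p, ?_, rfl⟩, ?_⟩
      · have : sphereMap L (sphereMap L.symm p) = p := by ext1; simp
        rwa [this]
      · apply L.injective
        simp [← h]
  rw [hset]
  exact (LinearIsometryEquiv.measurePreserving L).measure_preimage_equiv
    (f := L.toMeasurableEquiv) _

lemma productLaw_eq (d : ℕ) : productLaw d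
    = ((volume : Measure (Vec d)).toSphere Set.univ)⁻¹ • (volume : Measure (Vec d)).toSphere := by
  simp [productLaw, ProbabilityTheory.cond]

lemma measurePreserving_sphereMap (L : Vec d ≃ₗᵢ[ℝ] Vec d) :
    MeasurePreserving (sphereMap L) (productLaw d) (productLaw d) := by
  rw [productLaw_eq]
  exact (measurePreserving_sphereMap_toSphere L).smul_measure _

/-- A linear isometry carrying one vector to another one of the same norm. -/
lemma exists_isometry {v w : Vec d} (h : ‖v‖ = ‖w‖) : ∃ L : Vec d ≃ₗᵢ[ℝ] Vec d, L v = w :=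
  ⟨_, Submodule.reflection_sub h⟩

/-- The pairs of adjacent products. -/
def adjacentSet (d : ℕ) (ε : ℝ) : Set (Product d × Product d) :=
  {x | ‖(x.1 : Vec d) - (x.2 : Vec d)‖ ≤ ε}

lemma measurableSet_adjacentSet (ε : ℝ) : MeasurableSet (adjacentSet d ε) :=
  (isClosed_le (by fun_prop) continuous_const).measurableSet

/-- A rotation taking `p` to `p'` carries one spherical cap onto the other. This homogeneity is what
keeps the marginals uniform after conditioning. -/
lemma measure_adjacent_section (ε : ℝ) (p p' : Product d) :
    productLaw d (Prod.mk p ⁻¹' adjacentSet d ε) = productLaw d (Prod.mk p' ⁻¹' adjacentSet d ε) := by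
  obtain ⟨L, hL⟩ := exists_isometry (v := (p : Vec d)) (w := p') (by simp)
  conv_rhs => rw [← (measurePreserving_sphereMap L).measure_preimage
    (measurable_prodMk_left   (measurableSet_adjacentSet ε)).nullMeasurableSet]
  congr 1
  ext x
  simp [adjacentSet, ← hL, ← map_sub]

variable [NeZero d]

instance : IsProbabilityMeasure (productLaw d) := by
  unfold productLaw
  apply ProbabilityTheory.cond_isProbabilityMeasure
  rw [Measure.measure_univ_ne_zero]
  exact Measure.toSphere_ne_zero _

instance : (productLaw d).IsOpenPosMeasure := by
  rw [productLaw_eq]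
  exact Measure.isOpenPosMeasure_smul _ (ENNReal.inv_ne_zero.2 (measure_ne_top _ _))

instance : Nonempty (Product d) := (NormedSpace.sphere_nonempty.2 zero_le_one).to_subtype

/-- The uniform law charges open sets, and the strict version of adjacency is an open neighbourhood
of the diagonal. So the conditioning is never degenerate. -/
lemma adjacentSet_pos {ε : ℝ} (hε : 0 < ε) :
    (productLaw d).prod (productLaw d) (adjacentSet d ε) ≠ 0 := by
  obtain ⟨p⟩ : Nonempty (Product d) := inferInstance
  have ho : IsOpen {x : Product d × Product d | ‖(x.1 : Vec d) - (x.2 : Vec d)‖ < ε} :=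
    isOpen_lt (by fun_prop) continuous_const
  have := ho.measure_pos ((productLaw d).prod (productLaw d)) ⟨(p, p), by simpa using hε⟩
  refine (this.trans_le (measure_mono ?_)).ne'
  intro x (hx : ‖(x.1 : Vec d) - (x.2 : Vec d)‖ < ε)
  exact hx.le

lemma isProbabilityMeasure_adjacentProductLaw {ε : ℝ} (hε : 0 < ε) :
    IsProbabilityMeasure (adjacentProductLaw d ε) :=
  ProbabilityTheory.cond_isProbabilityMeasure (adjacentSet_pos hε)

lemma measurePreserving_sphereMap_adjacent (L : Vec d ≃ₗᵢ[ℝ] Vec d) (ε : ℝ) :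
    MeasurePreserving (Prod.map (sphereMap L) (sphereMap L))
      (adjacentProductLaw d ε) (adjacentProductLaw d ε) := by
  have h := (measurePreserving_sphereMap L).prod (measurePreserving_sphereMap L)
  have h2 := h.restrict_preimage (measurableSet_adjacentSet ε)
  have h3 : Prod.map (sphereMap L) (sphereMap L) ⁻¹' adjacentSet d ε = adjacentSet d ε := by
    ext x
    simp [adjacentSet, ← map_sub]
  rw [h3] at h2
  exact h2.smul_measure _

/-- All sections of the adjacency relation have the same mass `a`, which factors out of the
numerator and cancels against the normalisation. -/
lemma map_fst_adjacentProductLaw {ε : ℝ} (hε : 0 < ε) :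
    (adjacentProductLaw d ε).map Prod.fst = productLaw d := by
  obtain ⟨p₀⟩ : Nonempty (Product d) := inferInstance
  set a := productLaw d (Prod.mk p₀ ⁻¹' adjacentSet d ε)
  have hA : ∀ s, MeasurableSet s →
      (productLaw d).prod (productLaw d) (adjacentSet d ε ∩ Prod.fst ⁻¹' s) = a * productLaw d s := by
    intro s hs
    rw [Measure.prod_apply ((measurableSet_adjacentSet ε).inter (measurable_fst hs)),
      ← lintegral_indicator_const hs]
    congr 1 with p
    by_cases hp : p ∈ s
    · simp only [hp, Set.indicator_of_mem, a]
      rw [measure_adjacent_section ε p₀ p]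
      congr 1
      ext x
      simp [hp]
    · simp only [hp, not_false_eq_true, Set.indicator_of_notMem]
      rw [show Prod.mk p ⁻¹' (adjacentSet d ε ∩ Prod.fst ⁻¹' s) = ∅ by ext x; simp [hp],
        measure_empty]
  have h1 : (productLaw d).prod (productLaw d) (adjacentSet d ε) = a := by
    simpa using hA Set.univ .univ
  ext s hs
  rw [Measure.map_apply measurable_fst hs]
  change ProbabilityTheory.cond _ (adjacentSet d ε) _ = _
  rw [ProbabilityTheory.cond_apply (measurableSet_adjacentSet ε)]
  have h0 := adjacentSet_pos (d := d) hε
  rw [hA s hs, h1, ← mul_assoc, ENNReal.inv_mul_cancel, one_mul]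
  · rwa [← h1]
  · exact measure_ne_top _ _

lemma measurePreserving_fst_adjacent {ε : ℝ} (hε : 0 < ε) :
    MeasurePreserving Prod.fst (adjacentProductLaw d ε) (productLaw d) :=
  ⟨measurable_fst, map_fst_adjacentProductLaw hε⟩

lemma measurePreserving_swap_adjacent (ε : ℝ) :
    MeasurePreserving Prod.swap (adjacentProductLaw d ε) (adjacentProductLaw d ε) := by
  have h := Measure.measurePreserving_swap (μ := productLaw d) (ν := productLaw d)
  have h2 := h.restrict_preimage (measurableSet_adjacentSet ε)
  have h3 : Prod.swap ⁻¹' adjacentSet d ε = adjacentSet d ε := by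
    ext x
    simp [adjacentSet, norm_sub_rev]
  rw [h3] at h2
  exact h2.smul_measure _

lemma measurePreserving_snd_adjacent {ε : ℝ} (hε : 0 < ε) :
    MeasurePreserving Prod.snd (adjacentProductLaw d ε) (productLaw d) :=
  (measurePreserving_fst_adjacent hε).comp (measurePreserving_swap_adjacent ε)

end

/-! ### Moments and exponential moments of the uniform law on the sphere. -/

section

lemma integrable_of_continuous {X : Type*} [TopologicalSpace X] [CompactSpace X]
    [MeasurableSpace X] [OpensMeasurableSpace X] {μ : Measure X} [IsFiniteMeasure μ] {f : X → ℝ}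
    (hf : Continuous f) : Integrable f μ :=
  hf.integrable_of_hasCompactSupport (HasCompactSupport.of_compactSpace f)

variable {d : ℕ}

lemma integral_comp_inner_eq {f : ℝ → ℝ} (hf : Continuous f) {v w : Vec d} (h : ‖v‖ = ‖w‖) :
    ∫ p : Product d, f (inner ℝ v (p : Vec d)) ∂(productLaw d)
      = ∫ p : Product d, f (inner ℝ w (p : Vec d)) ∂(productLaw d) := by
  obtain ⟨L, rfl⟩ := exists_isometry h
  conv_rhs => rw [← (measurePreserving_sphereMap L).map_eq]
  rw [integral_map (continuous_sphereMap L).aemeasurable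
    (Continuous.aestronglyMeasurable (by fun_prop))]
  simp

variable [NeZero d]

/-- The moments of a coordinate of a uniform point of the sphere. -/
def sphereMoment (d : ℕ) [NeZero d] (n : ℕ) : ℝ :=
  ∫ p : Product d, (p : Vec d) 0 ^ n ∂(productLaw d)

lemma integral_inner_pow (v : Vec d) (n : ℕ) :
    ∫ p : Product d, inner ℝ v (p : Vec d) ^ n ∂(productLaw d) = ‖v‖ ^ n * sphereMoment d n := by
  rw [integral_comp_inner_eq (f := fun x => x ^ n) (by fun_prop)
    (w := ‖v‖ • EuclideanSpace.single (0 : Fin d) (1 : ℝ)) (by simp [norm_smul]),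
    sphereMoment, ← integral_const_mul]
  congr 1 with p
  rw [real_inner_smul_left, EuclideanSpace.inner_single_left, mul_pow]
  simp

lemma sphereMoment_zero : sphereMoment d 0 = 1 := by simp [sphereMoment]

lemma sphereMoment_odd (k : ℕ) : sphereMoment d (2 * k + 1) = 0 := by
  have h := integral_inner_pow (d := d) (-EuclideanSpace.single (0 : Fin d) (1 : ℝ)) (2 * k + 1)
  have h' := integral_inner_pow (d := d) (EuclideanSpace.single (0 : Fin d) (1 : ℝ)) (2 * k + 1)
  simp only [inner_neg_left, norm_neg, Odd.neg_pow (odd_two_mul_add_one k), integral_neg] at h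
  simp only [PiLp.norm_single, norm_one, one_pow, one_mul] at h h'
  linarith

/-- The moment of order $2k+2$ in the direction $e_0+te_i$ is $(1+t^2)^{k+1}$ times that in the
direction $e_0$. Comparing the coefficients of $t^2$ gives $\binom{2k+2}{2}=(k+1)(2k+1)$ mixed
moments on one side and $k+1$ pure moments on the other. -/
lemma sphereMoment_mixed (k : ℕ) {i : Fin d} (hi : i ≠ 0) :
    (2 * k + 1) * ∫ p : Product d, (p : Vec d) 0 ^ (2 * k) * (p : Vec d) i ^ 2 ∂(productLaw d)
      = sphereMoment d (2 * k + 2) := by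
  let Q : Polynomial ℝ := ∑ j ∈ Finset.range (2 * k + 2 + 1), Polynomial.C
    (∫ p : Product d, (p : Vec d) i ^ j * (p : Vec d) 0 ^ (2 * k + 2 - j) *
      ((2 * k + 2).choose j : ℝ) ∂(productLaw d)) * Polynomial.X ^ j
  let R : Polynomial ℝ := Polynomial.C (sphereMoment d (2 * k + 2)) *
    Polynomial.expand ℝ 2 ((1 + Polynomial.X) ^ (k + 1))
  have hQR : Q = R := by
    refine Polynomial.funext fun t => ?_
    have h := integral_inner_pow (d := d) (EuclideanSpace.single (0 : Fin d) (1 : ℝ)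
      + t • EuclideanSpace.single i (1 : ℝ)) (2 * k + 2)
    have hn : ‖EuclideanSpace.single (0 : Fin d) (1 : ℝ)
        + t • EuclideanSpace.single i (1 : ℝ)‖ ^ (2 * k + 2) = (1 + t ^ 2) ^ (k + 1) := by
      rw [show 2 * k + 2 = 2 * (k + 1) by ring, pow_mul, sq,
        norm_add_sq_eq_norm_sq_add_norm_sq_real]
      · simp [norm_smul, sq]
      · simp [EuclideanSpace.inner_single_left, hi.symm]
    rw [hn] at h
    have e1 : R.eval t = (1 + t ^ 2) ^ (k + 1) * sphereMoment d (2 * k + 2) := by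
      simp [R, mul_comm]
    have e2 : Q.eval t = ∫ p : Product d, inner ℝ (EuclideanSpace.single (0 : Fin d) (1 : ℝ)
        + t • EuclideanSpace.single i (1 : ℝ)) (p : Vec d) ^ (2 * k + 2) ∂(productLaw d) := by
      have : ∀ p : Product d, inner ℝ (EuclideanSpace.single (0 : Fin d) (1 : ℝ)
          + t • EuclideanSpace.single i (1 : ℝ)) (p : Vec d) ^ (2 * k + 2)
          = ∑ j ∈ Finset.range (2 * k + 2 + 1), (p : Vec d) i ^ j * (p : Vec d) 0 ^ (2 * k + 2 - j) *
      ((2 * k + 2).choose j : ℝ) * t ^ j := by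
        intro p
        rw [inner_add_left, real_inner_smul_left, EuclideanSpace.inner_single_left,
          EuclideanSpace.inner_single_left, add_comm, add_pow]
        refine Finset.sum_congr rfl fun j _ => ?_
        simp only [map_one, one_mul, mul_pow]
        ring
      simp_rw [this]
      rw [integral_finsetSum _ fun j _ => integrable_of_continuous (by fun_prop)]
      simp [Q, Polynomial.eval_finsetSum, integral_mul_const]
    rw [e1, e2, h]
  have hc := congrArg (fun P => Polynomial.coeff P 2) hQR
  have hR : R.coeff 2 = sphereMoment d (2 * k + 2) * (k + 1) := by
    simp only [R, Polynomial.coeff_C_mul]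
    rw [show 2 = 1 * 2 by rfl, Polynomial.coeff_expand_mul (by norm_num),
      Polynomial.coeff_one_add_X_pow]
    simp
  have hQ : Q.coeff 2 = ((k + 1) * (2 * k + 1)) *
      ∫ p : Product d, (p : Vec d) 0 ^ (2 * k) * (p : Vec d) i ^ 2 ∂(productLaw d) := by
    simp only [Q, Polynomial.finsetSum_coeff, Polynomial.coeff_C_mul_X_pow]
    rw [Finset.sum_eq_single 2 (fun j _ hj => by simp [hj.symm])
      (fun h => absurd (Finset.mem_range.2 (by omega)) h), if_pos rfl, integral_mul_const,
      show (2 * k + 2 - 2) = 2 * k by omega, Nat.choose_two_right,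
      show (2 * k + 2) * (2 * k + 2 - 1) = 2 * ((k + 1) * (2 * k + 1)) by
        rw [show 2 * k + 2 - 1 = 2 * k + 1 by omega]; ring, Nat.mul_div_cancel_left _ two_pos]
    push_cast
    simp_rw [mul_comm]
  simp only [hR, hQ] at hc
  have : (0 : ℝ) < k + 1 := by positivity
  apply mul_left_cancel₀ this.ne'
  linarith

/-- Insert $1=\sum_i p_i^2$ into the moment of order $2k$: the term $i=0$ is pure, and the other
$d-1$ are given by `sphereMoment_mixed`. -/
lemma sphereMoment_succ (k : ℕ) :
    (d + 2 * k) * sphereMoment d (2 * (k + 1)) = (2 * k + 1) * sphereMoment d (2 * k) := by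
  have h1 : sphereMoment d (2 * k) = ∑ i : Fin d,
      ∫ p : Product d, (p : Vec d) 0 ^ (2 * k) * (p : Vec d) i ^ 2 ∂(productLaw d) := by
    rw [← integral_finsetSum _ fun j _ => integrable_of_continuous (by fun_prop)]
    refine integral_congr_ae (.of_forall fun p => ?_)
    have : ∑ i, (p : Vec d) i ^ 2 = 1 := by
      rw [← EuclideanSpace.real_norm_sq_eq]; simp
    simp only
    rw [← Finset.mul_sum, this, mul_one]
  have h2 : (2 * k + 1) * sphereMoment d (2 * k) = (2 * k + 1) * sphereMoment d (2 * (k + 1))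
      + ∑ i ∈ Finset.univ.erase (0 : Fin d), sphereMoment d (2 * (k + 1)) := by
    rw [h1, ← Finset.add_sum_erase _ _ (Finset.mem_univ (0 : Fin d)), mul_add, Finset.mul_sum]
    congr 1
    · simp_rw [← pow_add]; rfl
    · exact Finset.sum_congr rfl fun i hi => sphereMoment_mixed k (Finset.ne_of_mem_erase hi)
  rw [h2, Finset.sum_const, Finset.card_erase_of_mem (Finset.mem_univ _), Finset.card_univ,
    Fintype.card_fin, nsmul_eq_mul, Nat.cast_sub (NeZero.one_le)]
  push_cast
  ring

/-- The even moments relative to those of a Gaussian of the same variance. -/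
def momentRatio (d : ℕ) [NeZero d] (k : ℕ) : ℝ :=
  sphereMoment d (2 * k) / (2 * k).factorial * (2 * d) ^ k * k.factorial

lemma momentRatio_succ (k : ℕ) : momentRatio d (k + 1) = momentRatio d k * (d / (d + 2 * k)) := by
  have hd : (0 : ℝ) < d := by exact_mod_cast NeZero.pos d
  have h := sphereMoment_succ (d := d) k
  have h2 : sphereMoment d (2 * (k + 1)) = (2 * k + 1) * sphereMoment d (2 * k) / (d + 2 * k) := by
    rw [← h]; field_simp
  have h3 : (((2 * (k + 1)).factorial : ℕ) : ℝ) = (2 * k + 2) * (2 * k + 1) * (2 * k).factorial := by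
    rw [show 2 * (k + 1) = 2 * k + 1 + 1 by ring, Nat.factorial_succ, Nat.factorial_succ]
    push_cast; ring
  have h4 : ((2 * k).factorial : ℝ) ≠ 0 := by positivity
  rw [momentRatio, momentRatio, h2, h3, Nat.factorial_succ]
  push_cast
  field_simp
  ring

/-- The ratio equals $\prod_{j<k}d/(d+2j)$, and the $j$-th factor is at least $1-2j/d$; the sum of
the $2j$ is $k(k-1)$. -/
lemma momentRatio_bounds (k : ℕ) :
    0 ≤ momentRatio d k ∧ momentRatio d k ≤ 1 ∧ 1 - k * (k - 1) / d ≤ momentRatio d k := by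
  have hd : (0 : ℝ) < d := by exact_mod_cast NeZero.pos d
  induction k with
  | zero => simp [momentRatio, sphereMoment_zero]
  | succ k ih =>
    obtain ⟨h0, h1, h2⟩ := ih
    rw [momentRatio_succ]
    have hq1 : (d : ℝ) / (d + 2 * k) ≤ 1 := div_le_one_of_le₀ (by linarith [k.cast_nonneg (α := ℝ)]) (by positivity)
    refine ⟨by positivity, mul_le_one₀ h1 (by positivity) hq1, ?_⟩
    have hq2 : 1 - 2 * k / (d : ℝ) ≤ d / (d + 2 * k) := by
      rw [le_div_iff₀ (by positivity)]
      have : (1 - 2 * k / (d : ℝ)) * (d + 2 * k) = d - (2 * k) ^ 2 / d := by field_simp; ring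
      rw [this]
      have : (0 : ℝ) ≤ (2 * k) ^ 2 / d := by positivity
      linarith
    have h3 : momentRatio d k - 2 * k / d ≤ momentRatio d k * (d / (d + 2 * k)) := by
      have : (0 : ℝ) ≤ 2 * k / d := by positivity
      nlinarith
    have h4 : (1 : ℝ) - ((k + 1 : ℕ) : ℝ) * (((k + 1 : ℕ) : ℝ) - 1) / d = 1 - k * (k - 1) / d - 2 * k / d := by
      push_cast; field_simp; ring
    linarith

/-- Integrate the exponential series term by term; odd moments vanish and the even ones give the
series of $e^{\|v\|^2/2d}$ weighted by `momentRatio`. -/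
lemma hasSum_integral_exp_inner (v : Vec d) :
    HasSum (fun k : ℕ => momentRatio d k * ((‖v‖ ^ 2 / (2 * d)) ^ k / k.factorial))
      (∫ p : Product d, Real.exp (inner ℝ v (p : Vec d)) ∂(productLaw d)) := by
  have hd : (0 : ℝ) < d := by exact_mod_cast NeZero.pos d
  have hb : ∀ p : Product d, |inner ℝ v (p : Vec d)| ≤ ‖v‖ := fun p => by
    simpa using abs_real_inner_le_norm v (p : Vec d)
  have hint : ∀ n : ℕ, Integrable (fun p : Product d => inner ℝ v (p : Vec d) ^ n / n.factorial)
      (productLaw d) := fun n => integrable_of_continuous (by fun_prop)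
  have h := hasSum_integral_of_summable_integral_norm (μ := productLaw d)
    (F := fun (n : ℕ) (p : Product d) => inner ℝ v (p : Vec d) ^ n / n.factorial) hint (by
      refine Summable.of_nonneg_of_le (fun n => integral_nonneg fun p => norm_nonneg _) (fun n => ?_)
        (Real.summable_pow_div_factorial ‖v‖)
      calc _ ≤ ∫ p : Product d, ‖v‖ ^ n / n.factorial ∂(productLaw d) := by
            refine integral_mono (hint n).norm (integrable_const _) fun p => ?_
            simp only [norm_div, norm_pow, Real.norm_eq_abs, Nat.abs_cast]
            gcongr
            exact hb p
        _ = _ := by simp)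
  have h2 : ∀ p : Product d, ∑' n : ℕ, inner ℝ v (p : Vec d) ^ n / (n.factorial : ℝ)
      = Real.exp (inner ℝ v (p : Vec d)) := fun p => by
    rw [Real.exp_eq_exp_ℝ, NormedSpace.exp_eq_tsum_div]
  simp only [h2, integral_div, integral_inner_pow] at h
  rw [← (mul_right_injective₀ (two_ne_zero (α := ℕ))).hasSum_iff] at h
  · refine (congrArg (HasSum · _) (funext fun k => ?_)).mpr h
    simp only [Function.comp, momentRatio]
    rw [div_pow, pow_mul]
    have : (k.factorial : ℝ) ≠ 0 := by positivity
    field_simp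
  · intro n hn
    rcases Nat.even_or_odd' n with ⟨k, rfl | rfl⟩
    · exact absurd ⟨k, rfl⟩ hn
    · simp [sphereMoment_odd]

lemma integral_exp_inner_le (v : Vec d) :
    ∫ p : Product d, Real.exp (inner ℝ v (p : Vec d)) ∂(productLaw d)
      ≤ Real.exp (‖v‖ ^ 2 / (2 * d)) := by
  have hd : (0 : ℝ) < d := by exact_mod_cast NeZero.pos d
  have h2 := NormedSpace.expSeries_div_hasSum_exp (𝔸 := ℝ) (‖v‖ ^ 2 / (2 * d))
  rw [← Real.exp_eq_exp_ℝ] at h2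
  exact hasSum_le (fun k => mul_le_of_le_one_left (by positivity) (momentRatio_bounds k).2.1)
    (hasSum_integral_exp_inner v) h2

/-- The loss $k(k-1)/d$ in the $k$-th coefficient is at most $4^k/d$, and $4^k$ turns the series at
$y$ into the series at $4y$. -/
lemma le_integral_exp_inner (v : Vec d) :
    Real.exp (‖v‖ ^ 2 / (2 * d)) - Real.exp (4 * (‖v‖ ^ 2 / (2 * d))) / d
      ≤ ∫ p : Product d, Real.exp (inner ℝ v (p : Vec d)) ∂(productLaw d) := by
  have hd : (0 : ℝ) < d := by exact_mod_cast NeZero.pos d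
  have h2 := NormedSpace.expSeries_div_hasSum_exp (𝔸 := ℝ) (‖v‖ ^ 2 / (2 * d))
  have h3 := NormedSpace.expSeries_div_hasSum_exp (𝔸 := ℝ) (4 * (‖v‖ ^ 2 / (2 * d)))
  rw [← Real.exp_eq_exp_ℝ] at h2 h3
  refine hasSum_le (fun k => ?_) (h2.sub (h3.div_const (d : ℝ))) (hasSum_integral_exp_inner v)
  set y := ‖v‖ ^ 2 / (2 * (d : ℝ))
  have hk : (k : ℝ) * (k - 1) ≤ 4 ^ k := by
    have h1 : (k : ℝ) ≤ 2 ^ k := by exact_mod_cast Nat.lt_two_pow_self.le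
    have : (4 : ℝ) ^ k = 2 ^ k * 2 ^ k := by rw [← mul_pow]; norm_num
    rw [this]
    nlinarith [k.cast_nonneg (α := ℝ)]
  have hm := (momentRatio_bounds (d := d) k).2.2
  have hy : 0 ≤ y ^ k / (k.factorial : ℝ) := by positivity
  have h5 : 1 - 4 ^ k / (d : ℝ) ≤ momentRatio d k := by
    refine le_trans ?_ hm
    gcongr
  calc y ^ k / (k.factorial : ℝ) - (4 * y) ^ k / k.factorial / d
      = (1 - 4 ^ k / (d : ℝ)) * (y ^ k / (k.factorial : ℝ)) := by rw [mul_pow]; ring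
    _ ≤ _ := by gcongr

end

/-! ### Exponential moments of adjacent pairs. -/

section

lemma abs_exp_sub_exp_le (a b : ℝ) :
    |Real.exp a - Real.exp b| ≤ |a - b| * (Real.exp a + Real.exp b) := by
  have key : ∀ a b : ℝ, b ≤ a → Real.exp a - Real.exp b ≤ (a - b) * Real.exp a := by
    intro a b _
    have h := Real.add_one_le_exp (b - a)
    have h2 : Real.exp b = Real.exp a * Real.exp (b - a) := by rw [← Real.exp_add]; ring_nf
    rw [h2]
    nlinarith [Real.exp_pos a]
  rcases le_total b a with h | h
  · rw [abs_of_nonneg (sub_nonneg.2 (Real.exp_le_exp.2 h)), abs_of_nonneg (sub_nonneg.2 h)]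
    nlinarith [key a b h, Real.exp_pos b, Real.exp_pos a]
  · rw [abs_sub_comm, abs_sub_comm a,
      abs_of_nonneg (sub_nonneg.2 (Real.exp_le_exp.2 h)), abs_of_nonneg (sub_nonneg.2 h)]
    nlinarith [key b a h, Real.exp_pos b, Real.exp_pos a]

variable {d : ℕ} [NeZero d]

lemma integral_inner_eq_zero (v : Vec d) :
    ∫ p : Product d, inner ℝ v (p : Vec d) ∂(productLaw d) = 0 := by
  have h := integral_inner_pow v 1
  have h2 : sphereMoment d 1 = 0 := sphereMoment_odd 0
  simpa [h2] using h

lemma integral_exp_inner_le_of_sq_le {v : Vec d} {y : ℝ} (hv : ‖v‖ ^ 2 ≤ y * d) (a : ℝ) :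
    ∫ p : Product d, Real.exp (a * inner ℝ v (p : Vec d)) ∂(productLaw d)
      ≤ Real.exp (a ^ 2 * y / 2) := by
  have hd : (0 : ℝ) < d := by exact_mod_cast NeZero.pos d
  have h := integral_exp_inner_le (a • v)
  simp only [real_inner_smul_left, norm_smul, mul_pow, Real.norm_eq_abs, sq_abs] at h
  refine h.trans (Real.exp_le_exp.2 ?_)
  rw [div_le_div_iff₀ (by positivity) two_pos]
  nlinarith [sq_nonneg a, mul_le_mul_of_nonneg_left hv (sq_nonneg a)]

variable {ε : ℝ}

lemma integral_fst_adjacent (hε : 0 < ε) {f : Product d → ℝ} (hf : Continuous f) :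
    ∫ x, f x.1 ∂(adjacentProductLaw d ε) = ∫ p, f p ∂(productLaw d) := by
  rw [← (measurePreserving_fst_adjacent hε).map_eq,
    integral_map measurable_fst.aemeasurable hf.aestronglyMeasurable]

lemma integral_snd_adjacent (hε : 0 < ε) {f : Product d → ℝ} (hf : Continuous f) :
    ∫ x, f x.2 ∂(adjacentProductLaw d ε) = ∫ p, f p ∂(productLaw d) := by
  rw [← (measurePreserving_snd_adjacent hε).map_eq,
    integral_map measurable_snd.aemeasurable hf.aestronglyMeasurable]

/-- By rotation invariance all coordinates of $p'-p$ have the same second moment, and these sum to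
at most $\epsilon^2$. Compared with Cauchy–Schwarz this gains a factor $d$, which offsets $\|v\|^2$
of order $d$. -/
lemma integral_inner_sub_sq_le (hε : 0 < ε) (v : Vec d) :
    d * ∫ x, inner ℝ v ((x.2 : Vec d) - x.1) ^ 2 ∂(adjacentProductLaw d ε) ≤ ‖v‖ ^ 2 * ε ^ 2 := by
  have := isProbabilityMeasure_adjacentProductLaw (d := d) hε
  have h1 : ∀ w : Vec d, ‖v‖ = ‖w‖ →
      ∫ x, inner ℝ v ((x.2 : Vec d) - x.1) ^ 2 ∂(adjacentProductLaw d ε)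
        = ∫ x, inner ℝ w ((x.2 : Vec d) - x.1) ^ 2 ∂(adjacentProductLaw d ε) := by
    intro w hw
    obtain ⟨L, rfl⟩ := exists_isometry hw
    conv_rhs => rw [← (measurePreserving_sphereMap_adjacent L ε).map_eq]
    rw [integral_map (measurePreserving_sphereMap_adjacent L ε).measurable.aemeasurable
      (Continuous.aestronglyMeasurable (by fun_prop))]
    simp [← map_sub]
  have h2 : ∀ i : Fin d, ∫ x, inner ℝ v ((x.2 : Vec d) - x.1) ^ 2 ∂(adjacentProductLaw d ε)
      = ‖v‖ ^ 2 * ∫ x, ((x.2 : Vec d) - x.1) i ^ 2 ∂(adjacentProductLaw d ε) := by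
    intro i
    rw [h1 (‖v‖ • EuclideanSpace.single i (1 : ℝ)) (by simp [norm_smul]), ← integral_const_mul]
    congr 1 with x
    rw [real_inner_smul_left, EuclideanSpace.inner_single_left, mul_pow]
    simp
  have h3 : d * ∫ x, inner ℝ v ((x.2 : Vec d) - x.1) ^ 2 ∂(adjacentProductLaw d ε)
      = ∑ i : Fin d, ‖v‖ ^ 2 * ∫ x, ((x.2 : Vec d) - x.1) i ^ 2 ∂(adjacentProductLaw d ε) := by
    simp_rw [← h2]
    simp
  rw [h3, ← Finset.mul_sum, ← integral_finsetSum _ fun j _ => integrable_of_continuous (by fun_prop)]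
  gcongr
  have h4 : ∀ᵐ x ∂(adjacentProductLaw d ε), x ∈ adjacentSet d ε :=
    ProbabilityTheory.ae_cond_mem (measurableSet_adjacentSet ε)
  calc _ ≤ ∫ x, ε ^ 2 ∂(adjacentProductLaw d ε) := by
        refine integral_mono_ae (integrable_of_continuous (by fun_prop)) (integrable_const _) ?_
        filter_upwards [h4] with x hx
        rw [← EuclideanSpace.real_norm_sq_eq, norm_sub_rev]
        gcongr
        exact hx
    _ = ε ^ 2 := by simp

/-- The inequality $2e^{X+Y}\le e^{2X}+e^{2Y}$ decouples the pair, and each marginal is uniform. -/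
lemma integral_exp_adjacent_le (hε : 0 < ε) {v w : Vec d} {y : ℝ} (hv : ‖v‖ ^ 2 ≤ y * d)
    (hw : ‖w‖ ^ 2 ≤ y * d) (a : ℝ) :
    ∫ x, Real.exp (a * (inner ℝ v (x.1 : Vec d) + inner ℝ w (x.2 : Vec d)))
      ∂(adjacentProductLaw d ε) ≤ Real.exp (2 * a ^ 2 * y) := by
  have := isProbabilityMeasure_adjacentProductLaw (d := d) hε
  have h1 := integral_exp_inner_le_of_sq_le hv (2 * a)
  have h2 := integral_exp_inner_le_of_sq_le hw (2 * a)
  rw [show (2 * a) ^ 2 * y / 2 = 2 * a ^ 2 * y by ring] at h1 h2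
  rw [← integral_fst_adjacent hε (by fun_prop)] at h1
  rw [← integral_snd_adjacent hε (by fun_prop)] at h2
  calc _ ≤ ∫ x, (Real.exp (2 * a * inner ℝ v (x.1 : Vec d)) / 2
        + Real.exp (2 * a * inner ℝ w (x.2 : Vec d)) / 2) ∂(adjacentProductLaw d ε) := by
        refine integral_mono (integrable_of_continuous (by fun_prop))
          (integrable_of_continuous (by fun_prop)) fun x => ?_
        simp only
        rw [mul_add, Real.exp_add, mul_assoc, mul_assoc, two_mul, two_mul, Real.exp_add,
          Real.exp_add]
        nlinarith [sq_nonneg (Real.exp (a * inner ℝ v (x.1 : Vec d))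
          - Real.exp (a * inner ℝ w (x.2 : Vec d)))]
    _ ≤ _ := by
        rw [integral_add (integrable_of_continuous (by fun_prop))
          (integrable_of_continuous (by fun_prop)), integral_div, integral_div]
        linarith

/-- Jensen in the form $e^x\ge1+x$, the linear terms having mean zero. -/
lemma one_le_integral_exp_adjacent (hε : 0 < ε) (v w : Vec d) :
    1 ≤ ∫ x, Real.exp (inner ℝ v (x.1 : Vec d) + inner ℝ w (x.2 : Vec d))
      ∂(adjacentProductLaw d ε) := by
  have := isProbabilityMeasure_adjacentProductLaw (d := d) hε
  calc (1 : ℝ) = ∫ x, ((inner ℝ v (x.1 : Vec d) + inner ℝ w (x.2 : Vec d)) + 1)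
        ∂(adjacentProductLaw d ε) := by
        rw [integral_add (integrable_of_continuous (by fun_prop)) (integrable_const _),
          integral_add (integrable_of_continuous (by fun_prop))
            (integrable_of_continuous (by fun_prop)),
          integral_fst_adjacent hε (f := fun p : Product d => inner ℝ v (p : Vec d)) (by fun_prop),
          integral_snd_adjacent hε (f := fun p : Product d => inner ℝ w (p : Vec d)) (by fun_prop),
          integral_inner_eq_zero, integral_inner_eq_zero]
        simp
    _ ≤ _ := integral_mono (integrable_of_continuous (by fun_prop))
          (integrable_of_continuous (by fun_prop)) fun x => Real.add_one_le_exp _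

lemma one_le_integral_exp (v : Vec d) :
    1 ≤ ∫ p : Product d, Real.exp (inner ℝ v (p : Vec d)) ∂(productLaw d) := by
  have h := one_le_integral_exp_adjacent (d := d) one_pos v 0
  simp only [inner_zero_left, add_zero] at h
  rwa [integral_fst_adjacent one_pos (f := fun p : Product d => Real.exp (inner ℝ v (p : Vec d)))
    (by fun_prop)] at h

/-- The exponents differ by $D=\langle w,p'-p\rangle$, whose second moment is at most $y\epsilon^2$.
Splitting $|D|(A+B)$ by Young's inequality with weight $\epsilon$ makes both $\epsilon^{-1}D^2$ and
$\epsilon(2A^2+2B^2)$ of order $\epsilon$ on average. -/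
lemma abs_integral_exp_adjacent_sub_le (hε : 0 < ε) {v w : Vec d} {y : ℝ}
    (hv : ‖v‖ ^ 2 ≤ y * d) (hw : ‖w‖ ^ 2 ≤ y * d) :
    |∫ x, Real.exp (inner ℝ v (x.1 : Vec d) + inner ℝ w (x.2 : Vec d)) ∂(adjacentProductLaw d ε)
      - ∫ p : Product d, Real.exp (inner ℝ (v + w) (p : Vec d)) ∂(productLaw d)|
      ≤ ε * (y + 4 * Real.exp (8 * y)) := by
  have := isProbabilityMeasure_adjacentProductLaw (d := d) hε
  have hd : (0 : ℝ) < d := by exact_mod_cast NeZero.pos d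
  have hsq : ∫ x, inner ℝ w ((x.2 : Vec d) - x.1) ^ 2 ∂(adjacentProductLaw d ε) ≤ y * ε ^ 2 := by
    have h := integral_inner_sub_sq_le (d := d) hε w
    have : d * ∫ x, inner ℝ w ((x.2 : Vec d) - x.1) ^ 2 ∂(adjacentProductLaw d ε)
        ≤ d * (y * ε ^ 2) := h.trans (by nlinarith [sq_nonneg ε])
    exact le_of_mul_le_mul_left this hd
  have ha := integral_exp_adjacent_le hε hv hw 2
  have hb : ∫ x, Real.exp (2 * (inner ℝ (v + w) (x.1 : Vec d))) ∂(adjacentProductLaw d ε)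
      ≤ Real.exp (8 * y) := by
    rw [integral_fst_adjacent hε (f := fun p : Product d => Real.exp (2 * (inner ℝ (v + w) (p : Vec d))))
      (by fun_prop)]
    refine (integral_exp_inner_le_of_sq_le (y := 4 * y) ?_ 2).trans_eq (by ring_nf)
    have : ‖v + w‖ ^ 2 ≤ (‖v‖ + ‖w‖) ^ 2 := by gcongr; exact norm_add_le _ _
    nlinarith [sq_nonneg (‖v‖ - ‖w‖)]
  rw [show (2 : ℝ) * 2 ^ 2 * y = 8 * y by ring] at ha
  rw [← integral_fst_adjacent hε (f := fun p : Product d => Real.exp (inner ℝ (v + w) (p : Vec d)))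
    (by fun_prop), ← integral_sub (integrable_of_continuous (by fun_prop))
      (integrable_of_continuous (by fun_prop))]
  refine abs_integral_le_integral_abs.trans ?_
  calc _ ≤ ∫ x, (ε⁻¹ * inner ℝ w ((x.2 : Vec d) - x.1) ^ 2
        + (2 * ε * Real.exp (2 * (inner ℝ v (x.1 : Vec d) + inner ℝ w (x.2 : Vec d)))
          + 2 * ε * Real.exp (2 * (inner ℝ (v + w) (x.1 : Vec d))))) ∂(adjacentProductLaw d ε) := by
        refine integral_mono (integrable_of_continuous (by fun_prop))
          (integrable_of_continuous (by fun_prop)) fun x => ?_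
        refine (abs_exp_sub_exp_le _ _).trans ?_
        have hD : inner ℝ v (x.1 : Vec d) + inner ℝ w (x.2 : Vec d) - inner ℝ (v + w) (x.1 : Vec d)
            = inner ℝ w ((x.2 : Vec d) - x.1) := by
          rw [inner_add_left, inner_sub_right]; ring
        simp only [hD]
        generalize inner ℝ w ((x.2 : Vec d) - x.1) = D
        simp only [two_mul (inner ℝ (v + w) _), two_mul (inner ℝ v _ + inner ℝ w _), Real.exp_add _ _]
        rw [← Real.exp_add]
        generalize Real.exp (inner ℝ v (x.1 : Vec d) + inner ℝ w (x.2 : Vec d)) = A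
        generalize Real.exp (inner ℝ (v + w) (x.1 : Vec d)) = B
        have h1 : ε⁻¹ * D ^ 2 = ε * (|D| / ε) ^ 2 := by
          rw [div_pow, sq_abs]; field_simp
        have h2 : |D| = ε * (|D| / ε) := by field_simp
        rw [h1]
        nth_rw 1 [h2]
        generalize |D| / ε = q
        have : q * (A + B) ≤ q ^ 2 + 2 * A * A + 2 * B * B := by
          nlinarith [sq_nonneg (q - (A + B)), sq_nonneg (A - B), sq_nonneg q, sq_nonneg (A + B)]
        nlinarith
    _ ≤ _ := by
        rw [integral_add (integrable_of_continuous (by fun_prop))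
          (integrable_of_continuous (by fun_prop)),
          integral_add (integrable_of_continuous (by fun_prop))
          (integrable_of_continuous (by fun_prop)), integral_const_mul, integral_const_mul,
          integral_const_mul]
        have e : ε⁻¹ * (y * ε ^ 2) = ε * y := by field_simp
        have : ε⁻¹ * ∫ x, inner ℝ w ((x.2 : Vec d) - x.1) ^ 2 ∂(adjacentProductLaw d ε) ≤ ε * y := by
          rw [← e]; gcongr
        nlinarith

end

/-! ### Concentration of sums of nonnegative variables with finite second moment. -/

section

section Truncation

open ProbabilityTheory

variable {Ω ι : Type*} [MeasurableSpace Ω] {μ : Measure Ω} [IsProbabilityMeasure μ]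

/-- On $|x|\le1$ one has $e^x\le1+x+x^2$; the linear term has mean zero and the variance is at most
the second moment. -/
lemma mgf_centered_le {y : Ω → ℝ} (hy : Measurable y) {M V t : ℝ}
    (h0 : ∀ ω, 0 ≤ y ω) (hM : ∀ ω, y ω ≤ M) (hV : ∫ ω, y ω ^ 2 ∂μ ≤ V) (ht : |t| * M ≤ 1) :
    mgf (fun ω => y ω - ∫ ω, y ω ∂μ) μ t ≤ Real.exp (V * t ^ 2) := by
  have hint : Integrable y μ := Integrable.of_bound hy.aestronglyMeasurable M
    (.of_forall fun ω => by rw [Real.norm_eq_abs, abs_of_nonneg (h0 ω)]; exact hM ω)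
  set a := ∫ ω, y ω ∂μ
  have ha0 : 0 ≤ a := integral_nonneg h0
  have haM : a ≤ M := by
    calc a ≤ ∫ ω, M ∂μ := integral_mono hint (integrable_const _) hM
      _ = M := by simp
  have hu : ∀ ω, |y ω - a| ≤ M := fun ω => abs_le.2 ⟨by linarith [h0 ω], by linarith [hM ω]⟩
  have hum : Measurable fun ω => y ω - a := hy.sub_const a
  have hui : Integrable (fun ω => y ω - a) μ := hint.sub (integrable_const _)
  have hu2 : Integrable (fun ω => (y ω - a) ^ 2) μ :=
    Integrable.of_bound (hum.pow_const 2).aestronglyMeasurable (M ^ 2)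
      (.of_forall fun ω => by
        rw [Real.norm_eq_abs, abs_pow]
        exact pow_le_pow_left₀ (abs_nonneg _) (hu ω) 2)
  have hvar : ∫ ω, (y ω - a) ^ 2 ∂μ ≤ V := by
    have h1 := variance_le_expectation_sq (μ := μ) (X := y) hy.aestronglyMeasurable
    rw [variance_eq_integral hy.aemeasurable] at h1
    exact h1.trans hV
  have htu : ∀ ω, |t * (y ω - a)| ≤ 1 := fun ω => by
    rw [abs_mul]
    exact (mul_le_mul_of_nonneg_left (hu ω) (abs_nonneg t)).trans ht
  have hpt : ∀ ω, Real.exp (t * (y ω - a)) ≤ 1 + t * (y ω - a) + t ^ 2 * (y ω - a) ^ 2 := fun ω => by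
    have := (abs_le.1 (Real.abs_exp_sub_one_sub_id_le (htu ω))).2
    rw [mul_pow] at this
    linarith
  calc mgf (fun ω => y ω - a) μ t
      ≤ ∫ ω, (1 + t * (y ω - a) + t ^ 2 * (y ω - a) ^ 2) ∂μ := by
        refine integral_mono ?_ ?_ hpt
        · refine Integrable.of_bound (by fun_prop) (Real.exp 1) (.of_forall fun ω => ?_)
          rw [Real.norm_eq_abs, Real.abs_exp]
          exact Real.exp_le_exp.2 ((le_abs_self _).trans (htu ω))
        · exact ((integrable_const _).add (hui.const_mul t)).add (hu2.const_mul _)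
    _ = 1 + t ^ 2 * ∫ ω, (y ω - a) ^ 2 ∂μ := by
        have h1 : Integrable (fun ω => 1 + t * (y ω - a)) μ :=
          (integrable_const _).add (hui.const_mul t)
        rw [integral_add h1 (hu2.const_mul _),
          integral_add (integrable_const _) (hui.const_mul t), integral_const_mul,
          integral_const_mul, integral_sub hint (integrable_const _)]
        simp [a]
    _ ≤ V * t ^ 2 + 1 := by nlinarith [sq_nonneg t]
    _ ≤ _ := Real.add_one_le_exp _

variable [Fintype ι]

/-- Chernoff at $t=\pm1/M$, the extreme values allowed by `mgf_centered_le`; the threshold is chosen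
so that the exponent is exactly $-\tau$. -/
lemma measureReal_abs_sum_centered_le {y : ι → Ω → ℝ} (hy : ∀ i, Measurable (y i))
    (hind : iIndepFun y μ) {M V τ : ℝ} (hMpos : 0 < M)
    (h0 : ∀ i ω, 0 ≤ y i ω) (hM : ∀ i ω, y i ω ≤ M) (hV : ∀ i, ∫ ω, y i ω ^ 2 ∂μ ≤ V) :
    μ.real {ω | Fintype.card ι * V / M + M * τ ≤ |∑ i, (y i ω - ∫ ω, y i ω ∂μ)|}
      ≤ 2 * Real.exp (-τ) := by
  set X : ι → Ω → ℝ := fun i ω => y i ω - ∫ ω, y i ω ∂μ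
  have hX : ∀ i, Measurable (X i) := fun i => (hy i).sub_const _
  have hXind : iIndepFun X μ :=
    hind.comp (fun i x => x - ∫ ω, y i ω ∂μ) fun i => measurable_id.sub_const _
  have hmgf : ∀ t : ℝ, |t| * M = 1 →
      mgf (∑ i, X i) μ t ≤ Real.exp (Fintype.card ι * V * t ^ 2) := by
    intro t ht
    rw [hXind.mgf_sum hX]
    calc ∏ i, mgf (X i) μ t ≤ ∏ _i : ι, Real.exp (V * t ^ 2) :=
          Finset.prod_le_prod (fun i _ => mgf_nonneg)
            fun i _ => mgf_centered_le (hy i) (h0 i) (hM i) (hV i) ht.le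
      _ = _ := by
          rw [Finset.prod_const, Finset.card_univ, ← Real.exp_nat_mul]; ring_nf
  have hbd : ∀ i ω, |X i ω| ≤ M := fun i ω => by
    have hint : Integrable (y i) μ := Integrable.of_bound (hy i).aestronglyMeasurable M
      (.of_forall fun ω => by rw [Real.norm_eq_abs, abs_of_nonneg (h0 i ω)]; exact hM i ω)
    have ha0 : 0 ≤ ∫ ω, y i ω ∂μ := integral_nonneg (h0 i)
    have haM : ∫ ω, y i ω ∂μ ≤ M := by
      calc _ ≤ ∫ ω, M ∂μ := integral_mono hint (integrable_const _) (hM i)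
        _ = M := by simp
    exact abs_le.2 ⟨by simp only [X]; linarith [h0 i ω], by simp only [X]; linarith [hM i ω]⟩
  have hint : ∀ t : ℝ, Integrable (fun ω => Real.exp (t * (∑ i, X i) ω)) μ := fun t => by
    refine Integrable.of_bound (Measurable.aestronglyMeasurable ?_)
      (Real.exp (|t| * (Fintype.card ι * M))) (.of_forall fun ω => ?_)
    · simp only [Finset.sum_apply]
      have := Finset.measurable_sum Finset.univ fun i _ => hX i
      exact Real.measurable_exp.comp (this.const_mul t)
    · rw [Real.norm_eq_abs, Real.abs_exp]
      refine Real.exp_le_exp.2 ((le_abs_self _).trans ?_)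
      rw [abs_mul, Finset.sum_apply]
      gcongr
      refine (Finset.abs_sum_le_sum_abs _ _).trans ((Finset.sum_le_sum fun i _ => hbd i ω).trans ?_)
      simp
  set r := Fintype.card ι * V / M + M * τ
  have hr : -(1 / M) * r + Fintype.card ι * V * (1 / M) ^ 2 = -τ := by
    simp only [r]; field_simp; ring
  have h1 : μ.real {ω | r ≤ (∑ i, X i) ω} ≤ Real.exp (-τ) := by
    refine (measure_ge_le_exp_mul_mgf r (t := 1 / M) (by positivity) (hint _)).trans ?_
    rw [← hr, Real.exp_add]
    gcongr
    exact hmgf _ (by rw [abs_of_pos (by positivity)]; field_simp)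
  have h2 : μ.real {ω | (∑ i, X i) ω ≤ -r} ≤ Real.exp (-τ) := by
    refine (measure_le_le_exp_mul_mgf (-r) (t := -(1 / M))
      (neg_nonpos.2 (by positivity)) (hint _)).trans ?_
    rw [← hr, Real.exp_add, show - -(1 / M) * -r = -(1 / M) * r by ring]
    gcongr
    rw [← neg_sq]
    exact neg_sq (1 / M) ▸ hmgf (-(1 / M)) (by
      rw [abs_neg, abs_of_pos (by positivity)]; field_simp)
  calc _ ≤ μ.real ({ω | r ≤ (∑ i, X i) ω} ∪ {ω | (∑ i, X i) ω ≤ -r}) := by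
        refine measureReal_mono ?_
        intro ω hω
        simp only [Set.mem_ofPred_eq, Set.mem_union, Finset.sum_apply] at hω ⊢
        rcases le_abs.1 hω with h | h
        · exact Or.inl h
        · exact Or.inr (by linarith)
    _ ≤ _ := (measureReal_union_le _ _).trans (by linarith)

/-- Concentration of a sum of independent nonnegative variables with bounded second moments, by
truncation at height `M`. -/
lemma measureReal_abs_sum_sub_le {W : ι → Ω → ℝ} (hW : ∀ i, Measurable (W i))
    (hind : iIndepFun W μ) {M V τ : ℝ} (hM : 0 < M) (h0 : ∀ i ω, 0 ≤ W i ω)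
    (hint : ∀ i, Integrable (fun ω => W i ω ^ 2) μ) (hV : ∀ i, ∫ ω, W i ω ^ 2 ∂μ ≤ V) :
    μ.real {ω | 2 * (Fintype.card ι * V / M) + M * τ ≤ |∑ i, W i ω - ∑ i, ∫ ω, W i ω ∂μ|}
      ≤ 2 * Real.exp (-τ) + ∑ i, μ.real {ω | M < W i ω} := by
  have hy : ∀ i, Measurable fun ω => min (W i ω) M := fun i => (hW i).min measurable_const
  have hy0 : ∀ i ω, 0 ≤ min (W i ω) M := fun i ω => le_min (h0 i ω) hM.le
  have hyi : ∀ i, Integrable (fun ω => min (W i ω) M) μ := fun i =>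
    Integrable.of_bound (hy i).aestronglyMeasurable M (.of_forall fun ω => by
      rw [Real.norm_eq_abs, abs_of_nonneg (hy0 i ω)]; exact min_le_right _ _)
  have hWi : ∀ i, Integrable (W i) μ := fun i => by
    refine ((hint i).add (integrable_const 1)).mono' (hW i).aestronglyMeasurable
      (.of_forall fun ω => ?_)
    rw [Real.norm_eq_abs, abs_of_nonneg (h0 i ω)]
    simp only [Pi.add_apply]
    nlinarith [sq_nonneg (W i ω - 1)]
  have hV' : ∀ i, ∫ ω, (min (W i ω) M) ^ 2 ∂μ ≤ V := fun i => by
    refine (integral_mono_of_nonneg (.of_forall fun ω => sq_nonneg _) (hint i)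
      (.of_forall fun ω => ?_)).trans (hV i)
    exact pow_le_pow_left₀ (hy0 i ω) (min_le_left _ _) 2
  -- Truncation only loses where $W>M$, and there $W-M\le W\le W^2/M$. This bias accounts for the
  -- second copy of $nV/M$ in the threshold.
  have hbias : ∀ i, |∫ ω, min (W i ω) M ∂μ - ∫ ω, W i ω ∂μ| ≤ V / M := fun i => by
    rw [← integral_sub (hyi i) (hWi i)]
    refine abs_integral_le_integral_abs.trans ?_
    calc _ ≤ ∫ ω, W i ω ^ 2 / M ∂μ := by
          refine integral_mono ((hyi i).sub (hWi i)).abs ((hint i).div_const M) fun ω => ?_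
          simp only
          rcases le_total (W i ω) M with h | h
          · rw [min_eq_left h, sub_self, abs_zero]; positivity
          · rw [min_eq_right h, abs_sub_comm, abs_of_nonneg (sub_nonneg.2 h), le_div_iff₀ hM]
            nlinarith
      _ ≤ V / M := by rw [integral_div]; gcongr; exact hV i
  have hsum : |∑ i, ∫ ω, min (W i ω) M ∂μ - ∑ i, ∫ ω, W i ω ∂μ| ≤ Fintype.card ι * V / M := by
    rw [← Finset.sum_sub_distrib]
    refine (Finset.abs_sum_le_sum_abs _ _).trans ((Finset.sum_le_sum fun i _ => hbias i).trans ?_)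
    simp [mul_div_assoc]
  have hc := measureReal_abs_sum_centered_le (τ := τ) hy
    (hind.comp (fun _ x => min x M) fun _ => measurable_id.min measurable_const) hM hy0
    (fun i ω => min_le_right _ _) hV'
  -- If no variable exceeds `M`, the truncated and original sums coincide.
  refine le_trans (b := μ.real ({ω | Fintype.card ι * V / M + M * τ
      ≤ |∑ i, (min (W i ω) M - ∫ ω, min (W i ω) M ∂μ)|} ∪ ⋃ i, {ω | M < W i ω}))
    (measureReal_mono ?_) ((measureReal_union_le _ _).trans
      (add_le_add hc (measureReal_iUnion_fintype_le _)))
  intro ω hω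
  by_contra hcon
  simp only [Set.mem_union, Set.mem_ofPred_eq, Set.mem_iUnion, not_or, not_exists, not_lt,
    not_le, Finset.sum_sub_distrib] at hcon hω
  simp only [min_eq_left (hcon.2 _)] at hcon
  have := abs_sub_le (∑ i, W i ω) (∑ i, ∫ ω, min (W i ω) M ∂μ) (∑ i, ∫ ω, W i ω ∂μ)
  linarith [hcon.1]

end Truncation

end

/-! ### Gaussian vectors: partition functions and norms. -/

section

section Gaussian

open ProbabilityTheory

variable {m d : ℕ}

instance : IsProbabilityMeasure (gaussianLaw m d) := by
  unfold gaussianLaw; infer_instance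

lemma map_inner_stdGaussian (p : Product d) :
    (stdGaussian (Vec d)).map (fun g => inner ℝ g (p : Vec d)) = gaussianReal 0 1 := by
  have h := IsGaussian.map_eq_gaussianReal (μ := stdGaussian (Vec d)) (innerSL ℝ (p : Vec d))
  rw [integral_strongDual_stdGaussian, variance_dual_stdGaussian, innerSL_apply_norm] at h
  have e : (fun g => inner ℝ g (p : Vec d)) = ⇑(innerSL ℝ (p : Vec d)) := by
    ext g; simp [real_inner_comm]
  rw [e, h]
  simp

lemma map_inner_gaussianLaw (p : Product d) (t : Fin m) :
    (gaussianLaw m d).map (fun g => inner ℝ (g t) (p : Vec d)) = gaussianReal 0 1 := by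
  rw [← map_inner_stdGaussian p,
    ← (measurePreserving_eval (fun _ : Fin m => stdGaussian (Vec d)) t).map_eq,
    Measure.map_map (by fun_prop)
      (show Measurable (Function.eval t : (Fin m → Vec d) → Vec d) from measurable_pi_apply t)]
  rfl

lemma mgf_inner_gaussianLaw (p : Product d) (t : Fin m) (a : ℝ) :
    mgf (fun g => inner ℝ (g t) (p : Vec d)) (gaussianLaw m d) a = Real.exp (a ^ 2 / 2) := by
  rw [mgf_gaussianReal (map_inner_gaussianLaw p t)]
  simp

lemma integrable_exp_inner_gaussianLaw (p : Product d) (t : Fin m) (a : ℝ) :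
    Integrable (fun g => Real.exp (a * inner ℝ (g t) (p : Vec d))) (gaussianLaw m d) := by
  rw [← mgf_pos_iff, mgf_inner_gaussianLaw]
  exact Real.exp_pos _

/-- Gaussian tail by Chernoff; `θ` is the optimal parameter for variance `b ^ 2`. -/
lemma measureReal_lt_exp_inner_le (p : Product d) (t : Fin m) {a b M : ℝ} (hb : 0 < b)
    (ha : |a| ≤ b) (hM : 1 ≤ M) :
    (gaussianLaw m d).real {g | M < Real.exp (a * inner ℝ (g t) (p : Vec d))}
      ≤ Real.exp (-(Real.log M ^ 2 / (2 * b ^ 2))) := by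
  have hl : 0 ≤ Real.log M := Real.log_nonneg hM
  set θ := Real.log M / b ^ 2
  have hint : Integrable (fun g => Real.exp (θ * (a * inner ℝ (g t) (p : Vec d))))
      (gaussianLaw m d) := by
    simpa only [mul_assoc] using integrable_exp_inner_gaussianLaw p t (θ * a)
  have h := measure_ge_le_exp_mul_mgf (Real.log M) (by positivity : 0 ≤ θ) hint
  have h2 : mgf (fun g : Fin m → Vec d => a * inner ℝ (g t) (p : Vec d)) (gaussianLaw m d) θ
      = Real.exp ((θ * a) ^ 2 / 2) := by
    rw [← mgf_inner_gaussianLaw p t (θ * a)]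
    simp only [mgf, mul_assoc]
  refine (measureReal_mono ?_).trans (h.trans ?_)
  · intro g (hg : M < _)
    exact (Real.log_le_iff_le_exp (by linarith)).2 hg.le
  · rw [h2, ← Real.exp_add]
    refine Real.exp_le_exp.2 ?_
    have h3 : (θ * a) ^ 2 ≤ θ ^ 2 * b ^ 2 := by
      rw [mul_pow]
      have := sq_le_sq' (by linarith [abs_le.1 ha]) (abs_le.1 ha).2
      gcongr
    have h4 : -θ * Real.log M + θ ^ 2 * b ^ 2 / 2 = -(Real.log M ^ 2 / (2 * b ^ 2)) := by
      simp only [θ]; field_simp; ring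
    linarith

/-- The partition function of a fixed product concentrates. -/
lemma measureReal_abs_partition_sub_le (p : Product d) {a : Fin m → ℝ} {b : ℝ} (hb : 1 ≤ b)
    (ha : ∀ t, |a t| ≤ b) (hm : 64 * b ^ 2 ≤ Real.log m) :
    (gaussianLaw m d).real {g | (2 * Real.exp (2 * b ^ 2) + 1) * (Real.log m * √m)
        ≤ |∑ t, Real.exp (a t * inner ℝ (g t) (p : Vec d)) - ∑ t, Real.exp (a t ^ 2 / 2)|}
      ≤ 3 * Real.exp (-(Real.log m ^ 2 / (64 * b ^ 2))) := by
  set L := Real.log m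
  have hL : 64 ≤ L := by nlinarith
  have hm0 : (0 : ℝ) < m := by
    rcases Nat.eq_zero_or_pos m with h | h
    · simp [L, h] at hL; linarith
    · exact_mod_cast h
  have hexp : Real.exp L = m := Real.exp_log hm0
  have hs : 0 < √(m : ℝ) := Real.sqrt_pos.2 hm0
  have hss : √(m : ℝ) * √(m : ℝ) = m := Real.mul_self_sqrt hm0.le
  have hLe : L ≤ Real.exp (L / 4) := by
    have := Real.quadratic_le_exp_of_nonneg (show 0 ≤ L / 4 by linarith)
    nlinarith
  have hsq : √(m : ℝ) = Real.exp (L / 2) := by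
    rw [Real.exp_half, hexp]
  -- The truncation height $\sqrt m/L$ is at least $m^{1/4}$, so its logarithm is of order $L$ and
  -- the lognormal tails beyond it are $e^{-cL^2}$.
  have hM4 : Real.exp (L / 4) ≤ √(m : ℝ) / L := by
    rw [le_div_iff₀ (by linarith), hsq, show L / 2 = L / 4 + L / 4 by ring, Real.exp_add]
    gcongr
  have hlogM : L / 4 ≤ Real.log (√(m : ℝ) / L) := (Real.le_log_iff_exp_le (by positivity)).2 hM4
  have hM1 : 1 ≤ √(m : ℝ) / L := (Real.one_le_exp (by linarith)).trans hM4
  have hind : iIndepFun (fun t (g : Fin m → Vec d) => Real.exp (a t * inner ℝ (g t) (p : Vec d)))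
      (gaussianLaw m d) :=
    iIndepFun_pi (X := fun t (g : Vec d) => Real.exp (a t * inner ℝ g (p : Vec d)))
      fun t => (Measurable.aemeasurable (by fun_prop))
  have hsqe : ∀ t (g : Fin m → Vec d), Real.exp (a t * inner ℝ (g t) (p : Vec d)) ^ 2
      = Real.exp (2 * a t * inner ℝ (g t) (p : Vec d)) := fun t g => by
    rw [sq, ← Real.exp_add]; ring_nf
  have ha2 : ∀ t, a t ^ 2 ≤ b ^ 2 := fun t =>
    sq_le_sq' (by linarith [abs_le.1 (ha t)]) (abs_le.1 (ha t)).2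
  -- With $M=\sqrt m/L$ and $\tau=L^2$, both the bias $mV/M$ and the deviation $M\tau$ are of order
  -- $L\sqrt m$.
  have key := measureReal_abs_sum_sub_le (μ := gaussianLaw m d) (τ := L ^ 2)
    (V := Real.exp (2 * b ^ 2)) (M := √(m : ℝ) / L) (fun t => by fun_prop) hind (by linarith)
    (fun t g => (Real.exp_pos _).le)
    (fun t => by simp_rw [hsqe]; exact integrable_exp_inner_gaussianLaw p t _)
    (fun t => by
      simp_rw [hsqe]
      refine (mgf_inner_gaussianLaw p t (2 * a t)).trans_le (Real.exp_le_exp.2 ?_)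
      nlinarith [ha2 t])
  have hmean : ∀ t, ∫ g, Real.exp (a t * inner ℝ (g t) (p : Vec d)) ∂(gaussianLaw m d)
      = Real.exp (a t ^ 2 / 2) := fun t => mgf_inner_gaussianLaw p t (a t)
  have hthr : 2 * ((Fintype.card (Fin m) : ℝ) * Real.exp (2 * b ^ 2) / (√(m : ℝ) / L))
      + √(m : ℝ) / L * L ^ 2 = (2 * Real.exp (2 * b ^ 2) + 1) * (L * √m) := by
    rw [Fintype.card_fin]
    nth_rewrite 1 [← hss]
    field_simp
  rw [hthr] at key
  simp only [hmean] at key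
  refine key.trans ?_
  have htail : ∀ t, (gaussianLaw m d).real {g | √(m : ℝ) / L
      < Real.exp (a t * inner ℝ (g t) (p : Vec d))} ≤ Real.exp (-(L ^ 2 / (32 * b ^ 2))) := fun t => by
    refine (measureReal_lt_exp_inner_le p t (by linarith) (ha t) hM1).trans (Real.exp_le_exp.2 ?_)
    rw [neg_le_neg_iff, show L ^ 2 / (32 * b ^ 2) = (L / 4) ^ 2 / (2 * b ^ 2) by field_simp; norm_num]
    gcongr
  have h1 : Real.exp (-(L ^ 2)) ≤ Real.exp (-(L ^ 2 / (64 * b ^ 2))) := by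
    refine Real.exp_le_exp.2 (neg_le_neg (div_le_self (sq_nonneg _) (by nlinarith)))
  -- The union bound costs a factor $m=e^L$, paid for by half of the exponent since $L\ge64b^2$.
  have h2 : ∑ t, (gaussianLaw m d).real {g | √(m : ℝ) / L
      < Real.exp (a t * inner ℝ (g t) (p : Vec d))} ≤ Real.exp (-(L ^ 2 / (64 * b ^ 2))) := by
    refine (Finset.sum_le_sum fun t _ => htail t).trans ?_
    rw [Finset.sum_const, Finset.card_univ, Fintype.card_fin, nsmul_eq_mul, ← hexp, ← Real.exp_add]
    refine Real.exp_le_exp.2 ?_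
    have : L ≤ L ^ 2 / (64 * b ^ 2) := by
      rw [le_div_iff₀ (by positivity)]; nlinarith
    have e : L ^ 2 / (32 * b ^ 2) = L ^ 2 / (64 * b ^ 2) + L ^ 2 / (64 * b ^ 2) := by
      field_simp; norm_num
    linarith
  linarith

lemma mgf_sq_gaussianReal : mgf (fun x => x ^ 2) (gaussianReal 0 1) (1 / 4) = √2 := by
  rw [mgf, integral_gaussianReal_eq_integral_smul (by simp)]
  have h := integral_gaussian (1 / 4)
  have h1 : ∀ x : ℝ, gaussianPDFReal 0 1 x • Real.exp (1 / 4 * x ^ 2)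
      = (√(2 * Real.pi))⁻¹ * Real.exp (-(1 / 4) * x ^ 2) := fun x => by
    rw [gaussianPDFReal, smul_eq_mul, mul_assoc, ← Real.exp_add]
    simp only [NNReal.coe_one, mul_one, sub_zero]
    ring_nf
  simp_rw [h1]
  rw [integral_const_mul, h, show Real.pi / (1 / 4) = (2 * Real.pi) * 2 by ring,
    Real.sqrt_mul (x := 2 * Real.pi) (by positivity)]
  have : √(2 * Real.pi) ≠ 0 := by positivity
  exact inv_mul_cancel_left₀ this _

/-- Chernoff for $\chi^2$ at parameter $1/4$, where each coordinate contributes $\sqrt2\le e^{1/2}$;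
the constant 6 leaves $-6/4+1/2=-1$ per dimension. -/
lemma stdGaussian_real_norm_sq_ge_le (d : ℕ) :
    (stdGaussian (Vec d)).real {g | 6 * d ≤ ‖g‖ ^ 2} ≤ Real.exp (-d) := by
  have hms : MeasurableSet {g : Vec d | 6 * (d : ℝ) ≤ ‖g‖ ^ 2} :=
    measurableSet_le measurable_const (by fun_prop)
  rw [← map_pi_eq_stdGaussian, map_measureReal_apply (by fun_prop) hms]
  set μ := Measure.pi fun _ : Fin d => gaussianReal 0 1
  have hmeas : ∀ i : Fin d, Measurable fun x : Fin d → ℝ => x i ^ 2 := fun i => by fun_prop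
  have hind : iIndepFun (fun (i : Fin d) (x : Fin d → ℝ) => x i ^ 2) μ :=
    iIndepFun_pi (X := fun _ (x : ℝ) => x ^ 2) fun t => (Measurable.aemeasurable (by fun_prop))
  have hmgf : ∀ i : Fin d, mgf (fun x : Fin d → ℝ => x i ^ 2) μ (1 / 4) = √2 := fun i => by
    rw [← mgf_sq_gaussianReal, ← (measurePreserving_eval (fun _ : Fin d => gaussianReal 0 1) i).map_eq,
      mgf_map (show Measurable (Function.eval i : (Fin d → ℝ) → ℝ) from
        measurable_pi_apply i).aemeasurable (by fun_prop)]
    rfl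
  have hint := hind.integrable_exp_mul_sum (t := 1 / 4) (s := Finset.univ) hmeas
    fun i _ => by rw [← mgf_pos_iff, hmgf]; positivity
  have h := measure_ge_le_exp_mul_mgf (6 * (d : ℝ)) (by norm_num : (0 : ℝ) ≤ 1 / 4) hint
  rw [hind.mgf_sum hmeas, Finset.prod_congr rfl fun i _ => hmgf i, Finset.prod_const,
    Finset.card_univ, Fintype.card_fin] at h
  have hset : WithLp.toLp 2 ⁻¹' {g : Vec d | 6 * (d : ℝ) ≤ ‖g‖ ^ 2}
      = {x | 6 * (d : ℝ) ≤ (∑ i : Fin d, fun x : Fin d → ℝ => x i ^ 2) x} := by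
    ext x
    simp [EuclideanSpace.real_norm_sq_eq]
  rw [hset]
  refine h.trans ?_
  have h2 : √2 ≤ Real.exp (1 / 2) := by
    have h1 : √2 ≤ 3 / 2 := by
      rw [Real.sqrt_le_left (by norm_num)]; norm_num
    linarith [Real.add_one_le_exp (1 / 2 : ℝ)]
  calc Real.exp (-(1 / 4) * (6 * d)) * √2 ^ d
      ≤ Real.exp (-(1 / 4) * (6 * d)) * Real.exp (1 / 2) ^ d := by gcongr
    _ = Real.exp (-d) := by
        rw [← Real.exp_nat_mul, ← Real.exp_add]; ring_nf

lemma gaussianLaw_exists_norm_sq_ge_le (L : Finset (Fin m)) :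
    gaussianLaw m d {g | ∃ t ∈ L, 6 * d ≤ ‖g t‖ ^ 2}
      ≤ ENNReal.ofReal (L.card * Real.exp (-d)) := by
  have h1 : ∀ t : Fin m, gaussianLaw m d {g | 6 * d ≤ ‖g t‖ ^ 2} ≤ ENNReal.ofReal (Real.exp (-d)) := by
    intro t
    have hms : MeasurableSet {g : Vec d | 6 * (d : ℝ) ≤ ‖g‖ ^ 2} :=
      measurableSet_le measurable_const (by fun_prop)
    have h2 := (measurePreserving_eval (fun _ : Fin m => stdGaussian (Vec d)) t).measure_preimage
      hms.nullMeasurableSet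
    refine h2.trans_le ?_
    rw [← ofReal_measureReal]
    exact ENNReal.ofReal_le_ofReal (stdGaussian_real_norm_sq_ge_le d)
  calc _ = gaussianLaw m d (⋃ t ∈ L, {g | 6 * d ≤ ‖g t‖ ^ 2}) := by
        congr 1; ext g; simp
    _ ≤ ∑ t ∈ L, gaussianLaw m d {g | 6 * d ≤ ‖g t‖ ^ 2} := measure_biUnion_finset_le _ _
    _ ≤ ∑ t ∈ L, ENNReal.ofReal (Real.exp (-d)) := Finset.sum_le_sum fun t _ => h1 t
    _ = _ := by
        rw [Finset.sum_const, nsmul_eq_mul, ENNReal.ofReal_mul (by positivity),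
          ENNReal.ofReal_natCast]

end Gaussian

end

/-! ### Comparing integrals of products of perturbed exponentials. -/

section

section ProductComparison

/-- Telescoping, one factor at a time; `η ≤ 1` gives $|P_i|\le A_i+E_i$ for the factors already
replaced. -/
lemma abs_prod_sub_prod_le {ι : Type*} (s : Finset ι) {P A E : ι → ℝ} {η : ℝ} (hη : 0 ≤ η)
    (hη1 : η ≤ 1) (hA : ∀ i, 0 ≤ A i) (hE : ∀ i, 0 ≤ E i) (h : ∀ i, |P i - A i| ≤ η * E i) :
    |∏ i ∈ s, P i - ∏ i ∈ s, A i| ≤ η * ∏ i ∈ s, (A i + E i) := by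
  classical
  induction s using Finset.induction_on with
  | empty => simpa using hη
  | insert j s hj ih =>
    rw [Finset.prod_insert hj, Finset.prod_insert hj, Finset.prod_insert hj]
    have hP : ∀ i, |P i| ≤ A i + E i := fun i => by
      have h1 : |P i| ≤ |P i - A i| + |A i| := by
        simpa using abs_add_le (P i - A i) (A i)
      rw [abs_of_nonneg (hA i)] at h1
      nlinarith [h i, hE i]
    have hprod : |∏ i ∈ s, P i| ≤ ∏ i ∈ s, (A i + E i) := by
      rw [Finset.abs_prod]
      exact Finset.prod_le_prod (fun i _ => abs_nonneg _) fun i _ => hP i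
    calc |P j * ∏ i ∈ s, P i - A j * ∏ i ∈ s, A i|
        = |A j * (∏ i ∈ s, P i - ∏ i ∈ s, A i) + (P j - A j) * ∏ i ∈ s, P i| := by ring_nf
      _ ≤ A j * |∏ i ∈ s, P i - ∏ i ∈ s, A i| + |P j - A j| * |∏ i ∈ s, P i| := by
          refine (abs_add_le _ _).trans_eq ?_
          rw [abs_mul, abs_mul, abs_of_nonneg (hA j)]
      _ ≤ A j * (η * ∏ i ∈ s, (A i + E i)) + (η * E j) * ∏ i ∈ s, (A i + E i) := by
          have := hA j
          have := hE j
          gcongr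
          exact h j
      _ = _ := by ring

variable {Ω ι : Type*} [MeasurableSpace Ω] {μ : Measure Ω} [IsProbabilityMeasure μ]

/-- Cauchy–Schwarz in the additive form $y\le\frac{\sigma}{2}y^2+\frac1{2\sigma}$, which is why the
size of `S` is measured by $\sigma^2$. -/
lemma integral_indicator_exp_le {X : Ω → ℝ} (hX : Integrable (fun ω => Real.exp (X ω)) μ)
    (hX2 : Integrable (fun ω => Real.exp (2 * X ω)) μ) {S : Set Ω} (hS : MeasurableSet S)
    {σ D : ℝ} (hσ : 0 < σ) (hSσ : μ.real S ≤ σ ^ 2) (hD : ∫ ω, Real.exp (2 * X ω) ∂μ ≤ D) :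
    ∫ ω, S.indicator (fun ω => Real.exp (X ω)) ω ∂μ ≤ σ * (D + 1) / 2 := by
  have hI : Integrable (S.indicator fun _ => (1 : ℝ)) μ := (integrable_const _).indicator hS
  calc _ ≤ ∫ ω, (σ / 2 * Real.exp (2 * X ω) + 1 / (2 * σ) * S.indicator (fun _ => (1 : ℝ)) ω) ∂μ := by
        refine integral_mono (hX.indicator hS) ((hX2.const_mul _).add (hI.const_mul _)) fun ω => ?_
        by_cases hω : ω ∈ S
        · simp only [Set.indicator_of_mem hω]
          rw [two_mul, Real.exp_add]
          generalize Real.exp (X ω) = y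
          have : σ / 2 * (y * y) + 1 / (2 * σ) * 1 - y = (σ * y - 1) ^ 2 / (2 * σ) := by
            field_simp; ring
          have : 0 ≤ (σ * y - 1) ^ 2 / (2 * σ) := by positivity
          linarith
        · simp only [Set.indicator_of_notMem hω, mul_zero, add_zero]
          positivity
    _ = σ / 2 * ∫ ω, Real.exp (2 * X ω) ∂μ + 1 / (2 * σ) * μ.real S := by
        rw [integral_add (hX2.const_mul _) (hI.const_mul _), integral_const_mul,
          integral_const_mul, integral_indicator_const _ hS]
        simp
    _ ≤ σ / 2 * D + 1 / (2 * σ) * σ ^ 2 := by gcongr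
    _ = _ := by field_simp

variable [Fintype ι]

/-- Off `S` the factors are compared one by one. On `S` only $0\le\prod P_i\le1$ is known, so the
term $\sigma^2$ is not proportional to $\prod a_i$ and must be absorbed later. -/
lemma abs_integral_prod_sub_le {P x : ι → Ω → ℝ} {a : ι → ℝ} {S : Set Ω} {η K σ D : ℝ}
    (hP : ∀ i, Measurable (P i)) (hP0 : ∀ i ω, 0 ≤ P i ω) (hP1 : ∀ i ω, P i ω ≤ 1)
    (ha : ∀ i, 0 ≤ a i) (hη : 0 ≤ η) (hη1 : η ≤ 1) (hK : 1 ≤ K) (hσ : 0 < σ)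
    (hS : MeasurableSet S) (hSσ : μ.real S ≤ σ ^ 2)
    (hPx : ∀ i, ∀ ω ∉ S, |P i ω - a i * Real.exp (x i ω)|
      ≤ η * (a i * (K * (Real.exp (x i ω) + 1))))
    (hint : ∀ s : Finset ι, Integrable (fun ω => Real.exp (∑ i ∈ s, x i ω)) μ)
    (hint2 : Integrable (fun ω => Real.exp (2 * ∑ i, x i ω)) μ)
    (hD : ∀ s : Finset ι, ∫ ω, Real.exp (∑ i ∈ s, x i ω) ∂μ ≤ D)
    (hD2 : ∫ ω, Real.exp (2 * ∑ i, x i ω) ∂μ ≤ D) :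
    |∫ ω, ∏ i, P i ω ∂μ - (∏ i, a i) * ∫ ω, Real.exp (∑ i, x i ω) ∂μ|
      ≤ (∏ i, a i) * (η * ((4 * K) ^ Fintype.card ι * D) + σ * (D + 1) / 2) + σ ^ 2 := by
  classical
  have ha' : 0 ≤ ∏ i, a i := Finset.prod_nonneg fun i _ => ha i
  have hPi : Integrable (fun ω => ∏ i, P i ω) μ :=
    Integrable.of_bound (Finset.measurable_prod _ fun i _ => hP i).aestronglyMeasurable 1
      (.of_forall fun ω => by
        rw [Real.norm_eq_abs, Finset.abs_prod]
        exact Finset.prod_le_one (fun i _ => abs_nonneg _) fun i _ => by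
          rw [abs_of_nonneg (hP0 i ω)]; exact hP1 i ω)
  have hA : ∀ ω, ∏ i, (a i * Real.exp (x i ω)) = (∏ i, a i) * Real.exp (∑ i, x i ω) := fun ω => by
    rw [Finset.prod_mul_distrib, Real.exp_sum]
  have hI : Integrable (S.indicator fun _ => (1 : ℝ)) μ := (integrable_const _).indicator hS
  have hIe : Integrable (S.indicator fun ω => Real.exp (∑ i, x i ω)) μ :=
    (hint Finset.univ).indicator hS
  set c := η * ((∏ i, a i) * (2 * K) ^ Fintype.card ι)
  have hc : 0 ≤ c := by positivity
  have hsum : Integrable (fun ω => ∑ s ∈ (Finset.univ : Finset ι).powerset,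
      Real.exp (∑ i ∈ s, x i ω)) μ := integrable_finsetSum _ fun s _ => hint s
  have hpt : ∀ ω, |∏ i, P i ω - (∏ i, a i) * Real.exp (∑ i, x i ω)|
      ≤ c * ∑ s ∈ (Finset.univ : Finset ι).powerset, Real.exp (∑ i ∈ s, x i ω)
        + (S.indicator (fun _ => (1 : ℝ)) ω
          + (∏ i, a i) * S.indicator (fun ω => Real.exp (∑ i, x i ω)) ω) := fun ω => by
    by_cases hω : ω ∈ S
    · simp only [Set.indicator_of_mem hω]
      have h1 : 0 ≤ ∏ i, P i ω := Finset.prod_nonneg fun i _ => hP0 i ω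
      have h2 : ∏ i, P i ω ≤ 1 := Finset.prod_le_one (fun i _ => hP0 i ω) fun i _ => hP1 i ω
      have h3 : 0 ≤ (∏ i, a i) * Real.exp (∑ i, x i ω) := by positivity
      have h4 : 0 ≤ c * ∑ s ∈ (Finset.univ : Finset ι).powerset, Real.exp (∑ i ∈ s, x i ω) := by
        positivity
      rw [abs_le]
      constructor <;> linarith
    · simp only [Set.indicator_of_notMem hω, mul_zero, add_zero]
      rw [← hA]
      refine (abs_prod_sub_prod_le Finset.univ hη hη1
        (fun i => mul_nonneg (ha i) (Real.exp_pos _).le)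
        (fun i => mul_nonneg (ha i) (by positivity)) fun i => hPx i ω hω).trans ?_
      -- Expanding $\prod(1+e^{x_i})$ over subsets is what requires exponential moments of all
      -- partial sums.
      rw [show c * ∑ s ∈ (Finset.univ : Finset ι).powerset, Real.exp (∑ i ∈ s, x i ω)
        = η * ∏ i, (a i * (2 * K) * (1 + Real.exp (x i ω))) by
          rw [Finset.prod_mul_distrib, Finset.prod_mul_distrib, Finset.prod_const,
            Finset.card_univ, Finset.prod_one_add]
          simp_rw [Real.exp_sum]
          simp only [c, mul_assoc]]
      refine mul_le_mul_of_nonneg_left (Finset.prod_le_prod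
        (fun i _ => add_nonneg (mul_nonneg (ha i) (Real.exp_pos _).le)
          (mul_nonneg (ha i) (by positivity))) fun i _ => ?_) hη
      rw [← mul_add, mul_assoc]
      refine mul_le_mul_of_nonneg_left ?_ (ha i)
      nlinarith [Real.exp_pos (x i ω)]
  have hI2 : Integrable (fun ω => S.indicator (fun _ => (1 : ℝ)) ω
      + (∏ i, a i) * S.indicator (fun ω => Real.exp (∑ i, x i ω)) ω) μ :=
    hI.add (hIe.const_mul _)
  rw [← integral_const_mul, ← integral_sub hPi ((hint _).const_mul _)]
  refine abs_integral_le_integral_abs.trans ((integral_mono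
    (hPi.sub ((hint _).const_mul _)).abs
    ((hsum.const_mul c).add hI2) hpt).trans ?_)
  simp only [Pi.add_apply]
  have hfin := integral_indicator_exp_le (hint _) hint2 hS hσ hSσ hD2
  rw [integral_add (hsum.const_mul c) hI2, integral_add hI (hIe.const_mul _),
    integral_const_mul, integral_const_mul, integral_finsetSum _ fun s _ => hint s,
    integral_indicator_const _ hS]
  have hs2 : ∑ s ∈ (Finset.univ : Finset ι).powerset, ∫ ω, Real.exp (∑ i ∈ s, x i ω) ∂μ
      ≤ 2 ^ Fintype.card ι * D := by
    refine (Finset.sum_le_sum fun s _ => hD s).trans_eq ?_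
    rw [Finset.sum_const, Finset.card_powerset, Finset.card_univ, nsmul_eq_mul]
    push_cast; rfl
  have h5 : c * ∑ s ∈ (Finset.univ : Finset ι).powerset, ∫ ω, Real.exp (∑ i ∈ s, x i ω) ∂μ
      ≤ (∏ i, a i) * (η * ((4 * K) ^ Fintype.card ι * D)) := by
    refine (mul_le_mul_of_nonneg_left hs2 hc).trans_eq ?_
    rw [show (4 : ℝ) * K = 2 * (2 * K) by ring, mul_pow 2 (2 * K)]
    simp only [c]; ring
  have h6 := mul_le_mul_of_nonneg_left hfin ha'
  simp only [smul_eq_mul, mul_one]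
  linarith

/-- A crude lower bound, obtained by discarding `S`. It provides positivity and a floor for
logarithms even when the two-sided estimate has relative error above 1, as for a large radius. -/
lemma le_integral_prod {P x : ι → Ω → ℝ} {a : ι → ℝ} {S : Set Ω} {θ σ D : ℝ}
    (hP : ∀ i, Measurable (P i)) (hP0 : ∀ i ω, 0 ≤ P i ω) (hP1 : ∀ i ω, P i ω ≤ 1)
    (ha : ∀ i, 0 ≤ a i) (hθ : 0 ≤ θ) (hσ : 0 < σ)
    (hS : MeasurableSet S) (hSσ : μ.real S ≤ σ ^ 2)
    (hPx : ∀ i, ∀ ω ∉ S, θ * (a i * Real.exp (x i ω)) ≤ P i ω)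
    (hint : Integrable (fun ω => Real.exp (∑ i, x i ω)) μ)
    (hint2 : Integrable (fun ω => Real.exp (2 * ∑ i, x i ω)) μ)
    (hD2 : ∫ ω, Real.exp (2 * ∑ i, x i ω) ∂μ ≤ D) :
    (∏ i, a i) * (θ ^ Fintype.card ι * (∫ ω, Real.exp (∑ i, x i ω) ∂μ - σ * (D + 1) / 2))
      ≤ ∫ ω, ∏ i, P i ω ∂μ := by
  have ha' : 0 ≤ ∏ i, a i := Finset.prod_nonneg fun i _ => ha i
  have hPi : Integrable (fun ω => ∏ i, P i ω) μ :=
    Integrable.of_bound (Finset.measurable_prod _ fun i _ => hP i).aestronglyMeasurable 1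
      (.of_forall fun ω => by
        rw [Real.norm_eq_abs, Finset.abs_prod]
        exact Finset.prod_le_one (fun i _ => abs_nonneg _) fun i _ => by
          rw [abs_of_nonneg (hP0 i ω)]; exact hP1 i ω)
  have hIe : Integrable (S.indicator fun ω => Real.exp (∑ i, x i ω)) μ := hint.indicator hS
  have hfin := integral_indicator_exp_le hint hint2 hS hσ hSσ hD2
  calc _ ≤ ((∏ i, a i) * θ ^ Fintype.card ι) * (∫ ω, Real.exp (∑ i, x i ω) ∂μ
        - ∫ ω, S.indicator (fun ω => Real.exp (∑ i, x i ω)) ω ∂μ) := by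
        rw [mul_assoc]; gcongr
    _ = ∫ ω, ((∏ i, a i) * θ ^ Fintype.card ι) * (Real.exp (∑ i, x i ω)
        - S.indicator (fun ω => Real.exp (∑ i, x i ω)) ω) ∂μ := by
        rw [integral_const_mul, integral_sub hint hIe]
    _ ≤ _ := by
        refine integral_mono ((hint.sub hIe).const_mul _) hPi fun ω => ?_
        by_cases hω : ω ∈ S
        · simp only [Set.indicator_of_mem hω, sub_self, mul_zero]
          exact Finset.prod_nonneg fun i _ => hP0 i ω
        · simp only [Set.indicator_of_notMem hω, sub_zero]
          have : (∏ i, a i) * θ ^ Fintype.card ι * Real.exp (∑ i, x i ω)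
              = ∏ i, (θ * (a i * Real.exp (x i ω))) := by
            rw [Finset.prod_mul_distrib, Finset.prod_mul_distrib, Finset.prod_const,
              Finset.card_univ, Real.exp_sum]
            ring
          rw [this]
          exact Finset.prod_le_prod (fun i _ => mul_nonneg hθ (mul_nonneg (ha i) (Real.exp_pos _).le))
            fun i _ => hPx i ω hω

end ProductComparison

end

/-! ### Trigram probabilities at typical products. -/

section

section Trigrams

variable {N m d : ℕ} (P : Params N) (T : Fin m → Vec d)

lemma Params.α_pos (i : Fin N) : 0 < P.α i := by linarith [P.half_lt_α i]

lemma partition_pos (hm : 0 < m) (p : Product d) (i : Fin N) : 0 < partition P T p i := by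
  have : Nonempty (Fin m) := ⟨⟨0, hm⟩⟩
  exact Finset.sum_pos (fun t _ => Real.exp_pos _) Finset.univ_nonempty

lemma continuous_partition (i : Fin N) : Continuous fun p : Product d => partition P T p i := by
  unfold partition; fun_prop

lemma continuous_trigramProb (hm : 0 < m) (i : Fin N) (t : Fin m) :
    Continuous fun p : Product d => trigramProb P T p i t := by
  unfold trigramProb
  have h := continuous_partition P T i
  have h0 : ∀ p : Product d, partition P T p i ≠ 0 := fun p => (partition_pos P T hm p i).ne'
  fun_prop (disch := exact h0 _)

lemma trigramProb_pos (hm : 0 < m) (p : Product d) (i : Fin N) (t : Fin m) :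
    0 < trigramProb P T p i t := by
  have h1 := partition_pos P T hm p i
  have h2 := P.α_pos i
  have h3 := sub_nonneg.2 (P.α_le_one i)
  unfold trigramProb
  positivity

lemma trigramProb_le_one (hm : 0 < m) (p : Product d) (i : Fin N) (t : Fin m) :
    trigramProb P T p i t ≤ 1 := by
  have h1 := partition_pos P T hm p i
  have h2 := P.α_pos i
  have h3 := sub_nonneg.2 (P.α_le_one i)
  have h4 : Real.exp (P.β i * inner ℝ (T t) (p : Vec d)) / partition P T p i ≤ 1 := by
    rw [div_le_one h1]
    exact Finset.single_le_sum (f := fun t => Real.exp (P.β i * inner ℝ (T t) (p : Vec d)))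
      (fun t _ => (Real.exp_pos _).le) (Finset.mem_univ t)
  have h5 : 1 / (m : ℝ) ≤ 1 := by
    rw [div_le_one (by exact_mod_cast hm)]; exact_mod_cast hm
  unfold trigramProb
  nlinarith

variable (s : Fin m → ℝ)

lemma natCast_le_meanPartition (i : Fin N) : (m : ℝ) ≤ meanPartition P s i := by
  calc (m : ℝ) = ∑ _t : Fin m, (1 : ℝ) := by simp
    _ ≤ _ := Finset.sum_le_sum fun t _ => Real.one_le_exp (by positivity)

variable {P s} in
lemma meanPartition_le {b : ℝ} (hb : ∀ i t, |P.β i * s t| ≤ b) (i : Fin N) :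
    meanPartition P s i ≤ m * Real.exp (b ^ 2 / 2) := by
  calc _ ≤ ∑ _t : Fin m, Real.exp (b ^ 2 / 2) := Finset.sum_le_sum fun t _ => by
        have := sq_le_sq' (by linarith [(abs_le.1 (hb i t)).1]) (abs_le.1 (hb i t)).2
        gcongr
    _ = _ := by simp

/-- The products for which some partition function is far from its mean. -/
def atypicalSet (δ : ℝ) : Set (Product d) :=
  {p | ∃ i, δ * meanPartition P s i ≤ |partition P T p i - meanPartition P s i|}

lemma measurableSet_atypicalSet (δ : ℝ) : MeasurableSet (atypicalSet P T s δ) := by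
  have : atypicalSet P T s δ
      = ⋃ i, {p | δ * meanPartition P s i ≤ |partition P T p i - meanPartition P s i|} := by
    ext p; simp [atypicalSet]
  rw [this]
  exact MeasurableSet.iUnion fun i => measurableSet_le measurable_const
    (((continuous_partition P T i).sub continuous_const).abs.measurable)

/-- The largest weight of the uniform component. -/
def noiseWeight : ℝ := ⨆ i, (1 - P.α i)

lemma one_sub_α_le_noiseWeight (i : Fin N) : 1 - P.α i ≤ noiseWeight P :=
  le_ciSup (f := fun i => 1 - P.α i) (Set.finite_range _).bddAbove i

/-- This includes `N = 0`, where the supremum of the empty family is 0 by convention. -/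
lemma noiseWeight_nonneg : 0 ≤ noiseWeight P :=
  Real.iSup_nonneg fun i => sub_nonneg.2 (P.α_le_one i)

lemma noiseWeight_le : noiseWeight P ≤ 1 / 2 :=
  Real.iSup_le (fun i => by linarith [P.half_lt_α i]) (by norm_num)

variable {P T s} {b δ : ℝ}

/-- Replacing the partition function costs a relative error $2\delta$. The noise $(1-\alpha)/m$ is
comparable to $(1-\alpha)\alpha/Z$ because $Z\le me^{b^2/2}$ and $\alpha>1/2$, but it lacks the
factor $e^{x}$; hence the `+ 1`. -/
lemma abs_trigramProb_sub_le (hm : 0 < m) (hb : ∀ i t, |P.β i * s t| ≤ b) (hδ : δ ≤ 1 / 2)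
    (hδ0 : 0 ≤ δ) {p : Product d} (hp : p ∉ atypicalSet P T s δ) (i : Fin N) (t : Fin m) :
    |trigramProb P T p i t - P.α i / meanPartition P s i
        * Real.exp (P.β i * inner ℝ (T t) (p : Vec d))|
      ≤ (δ + noiseWeight P) * (P.α i / meanPartition P s i * (2 * Real.exp (b ^ 2 / 2)
        * (Real.exp (P.β i * inner ℝ (T t) (p : Vec d)) + 1))) := by
  have hZp := partition_pos P T hm p i
  have hm' : (0 : ℝ) < m := by exact_mod_cast hm
  have hZ1 := natCast_le_meanPartition P s i
  have hZ2 := meanPartition_le hb i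
  have hα := P.α_pos i
  have hα2 := P.half_lt_α i
  have hα1 := sub_nonneg.2 (P.α_le_one i)
  have hw := one_sub_α_le_noiseWeight P i
  simp only [atypicalSet, Set.mem_ofPred_eq, not_exists, not_le] at hp
  have hpi := hp i
  have hK : 1 ≤ Real.exp (b ^ 2 / 2) := Real.one_le_exp (by positivity)
  have hu : 0 < Real.exp (P.β i * inner ℝ (T t) (p : Vec d)) := Real.exp_pos _
  unfold trigramProb
  generalize Real.exp (P.β i * inner ℝ (T t) (p : Vec d)) = u at *
  generalize partition P T p i = Y at *
  generalize meanPartition P s i = Z at *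
  generalize Real.exp (b ^ 2 / 2) = K at *
  have hZ : 0 < Z := by linarith
  have hY2 : Z / 2 ≤ Y := by nlinarith [(abs_lt.1 hpi).1]
  have h1 : |u / Y - u / Z| ≤ 2 * δ * u / Z := by
    have e : u / Y - u / Z = u * (Z - Y) / (Y * Z) := by field_simp
    rw [e, abs_div, abs_mul, abs_of_pos hu, abs_of_pos (mul_pos hZp hZ), abs_sub_comm,
      div_le_div_iff₀ (mul_pos hZp hZ) hZ]
    have : |Y - Z| ≤ 2 * δ * Y := by nlinarith
    calc u * |Y - Z| * Z ≤ u * (2 * δ * Y) * Z := by gcongr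
      _ = _ := by ring
  have h2 : 1 / (m : ℝ) ≤ K / Z := by
    rw [div_le_div_iff₀ hm' hZ]; linarith
  have h3 : (1 - P.α i) * (1 / (m : ℝ)) ≤ noiseWeight P * (2 * P.α i * (K / Z)) := by
    have h4 : 0 ≤ K / Z := by positivity
    refine mul_le_mul hw (h2.trans ?_) (by positivity) (hα1.trans hw)
    nlinarith
  have h5 : 0 ≤ (1 - P.α i) * (1 / (m : ℝ)) := by positivity
  calc |P.α i * (u / Y) + (1 - P.α i) * (1 / (m : ℝ)) - P.α i / Z * u|
      = |P.α i * (u / Y - u / Z) + (1 - P.α i) * (1 / (m : ℝ))| := by ring_nf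
    _ ≤ P.α i * |u / Y - u / Z| + (1 - P.α i) * (1 / (m : ℝ)) := by
        refine (abs_add_le _ _).trans_eq ?_
        rw [abs_mul, abs_of_pos hα, abs_of_nonneg h5]
    _ ≤ P.α i * (2 * δ * u / Z) + noiseWeight P * (2 * P.α i * (K / Z)) := by gcongr
    _ = P.α i / Z * (2 * δ * u + 2 * noiseWeight P * K) := by field_simp
    _ ≤ P.α i / Z * ((δ + noiseWeight P) * (2 * K * (u + 1))) := by
        have hw0 := noiseWeight_nonneg P
        have h6 : 0 ≤ P.α i / Z := by positivity
        refine mul_le_mul_of_nonneg_left ?_ h6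
        have h7 : δ * u ≤ δ * u * K := le_mul_of_one_le_right (by positivity) hK
        have h8 : 0 ≤ δ * K := by positivity
        have h9 : 0 ≤ noiseWeight P * K * u := by positivity
        nlinarith
    _ = _ := by ring

lemma le_trigramProb (hm : 0 < m) (hδ : δ ≤ 1 / 2)
    {p : Product d} (hp : p ∉ atypicalSet P T s δ) (i : Fin N) (t : Fin m) :
    1 / 2 * (P.α i / meanPartition P s i * Real.exp (P.β i * inner ℝ (T t) (p : Vec d)))
      ≤ trigramProb P T p i t := by
  have hZp := partition_pos P T hm p i
  have hm' : (0 : ℝ) < m := by exact_mod_cast hm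
  have hZ1 := natCast_le_meanPartition P s i
  have hα := P.α_pos i
  have hα1 := sub_nonneg.2 (P.α_le_one i)
  simp only [atypicalSet, Set.mem_ofPred_eq, not_exists, not_le] at hp
  have hpi := hp i
  have hu : 0 < Real.exp (P.β i * inner ℝ (T t) (p : Vec d)) := Real.exp_pos _
  unfold trigramProb
  generalize Real.exp (P.β i * inner ℝ (T t) (p : Vec d)) = u at *
  generalize partition P T p i = Y at *
  generalize meanPartition P s i = Z at *
  have hZ : 0 < Z := by linarith
  have hY2 : Y ≤ 2 * Z := by nlinarith [(abs_lt.1 hpi).2]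
  have h5 : 0 ≤ (1 - P.α i) * (1 / (m : ℝ)) := by positivity
  calc 1 / 2 * (P.α i / Z * u) = P.α i * (u / (2 * Z)) := by field_simp
    _ ≤ P.α i * (u / Y) := by gcongr
    _ ≤ _ := by linarith

/-- The Gibbs weight is at least an inverse power of $m$, so an additive error smaller than every
power of $m$ becomes a relative one. -/
lemma one_le_prod_mul_pow {ι : Type*} [Fintype ι] (hm : 0 < m) (hb : ∀ i t, |P.β i * s t| ≤ b)
    (pos : ι → Fin N) {M : ℕ} (hι : Fintype.card ι ≤ M) :
    1 ≤ (∏ i, P.α (pos i) / meanPartition P s (pos i)) * (2 * m * Real.exp (b ^ 2 / 2)) ^ M := by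
  have hm' : (1 : ℝ) ≤ m := by exact_mod_cast hm
  have hK : 1 ≤ Real.exp (b ^ 2 / 2) := Real.one_le_exp (by positivity)
  have hbase : 1 ≤ 2 * m * Real.exp (b ^ 2 / 2) := by nlinarith
  have hpos : ∀ i, 0 ≤ P.α (pos i) / meanPartition P s (pos i) := fun i =>
    div_nonneg (P.α_pos _).le (by linarith [natCast_le_meanPartition P s (pos i)])
  calc 1 = ∏ _i : ι, (1 : ℝ) := by simp
    _ ≤ ∏ i, (P.α (pos i) / meanPartition P s (pos i) * (2 * m * Real.exp (b ^ 2 / 2))) := by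
        refine Finset.prod_le_prod (fun _ _ => zero_le_one) fun i _ => ?_
        have hZ1 := natCast_le_meanPartition P s (pos i)
        have hZ2 := meanPartition_le hb (pos i)
        have := P.half_lt_α (pos i)
        rw [div_mul_eq_mul_div, le_div_iff₀ (by linarith)]
        nlinarith
    _ = (∏ i, P.α (pos i) / meanPartition P s (pos i))
        * (2 * m * Real.exp (b ^ 2 / 2)) ^ Fintype.card ι := by
        rw [Finset.prod_mul_distrib, Finset.prod_const, Finset.card_univ]
    _ ≤ _ := by
        have := Finset.prod_nonneg fun i (_ : i ∈ Finset.univ) => hpos i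
        gcongr

section Mixture

variable {Ω ι : Type*} [MeasurableSpace Ω] {μ : Measure Ω} [IsProbabilityMeasure μ] [Fintype ι]
  {π : ι → Ω → Product d} {pos : ι → Fin N} {tr : ι → Fin m} {σ D : ℝ}

/-- Trigrams generated at given positions by given products: the probability of the sequence is
close to the Gibbs weight with deterministic partition functions. -/
lemma abs_integral_prod_trigramProb_sub_le (hm : 0 < m) (hb : ∀ i t, |P.β i * s t| ≤ b)
    (hδ : δ ≤ 1 / 2) (hδ0 : 0 ≤ δ) (hπ : ∀ i, Measurable (π i)) (hι : Fintype.card ι ≤ 2 * N)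
    (hσ : 0 < σ) (hS : μ.real (⋃ i, π i ⁻¹' atypicalSet P T s δ) ≤ σ ^ 2)
    (hint : ∀ J : Finset ι, Integrable
      (fun ω => Real.exp (∑ i ∈ J, P.β (pos i) * inner ℝ (T (tr i)) (π i ω : Vec d))) μ)
    (hint2 : Integrable
      (fun ω => Real.exp (2 * ∑ i, P.β (pos i) * inner ℝ (T (tr i)) (π i ω : Vec d))) μ)
    (hD : ∀ J : Finset ι,
      ∫ ω, Real.exp (∑ i ∈ J, P.β (pos i) * inner ℝ (T (tr i)) (π i ω : Vec d)) ∂μ ≤ D)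
    (hD2 : ∫ ω, Real.exp (2 * ∑ i, P.β (pos i) * inner ℝ (T (tr i)) (π i ω : Vec d)) ∂μ ≤ D)
    (hσD : σ * (D + 1) ≤ δ) (hσm : σ ^ 2 * (2 * m * Real.exp (b ^ 2 / 2)) ^ (2 * N) ≤ δ) :
    |∫ ω, ∏ i, trigramProb P T (π i ω) (pos i) (tr i) ∂μ
        - (∏ i, P.α (pos i) / meanPartition P s (pos i))
          * ∫ ω, Real.exp (∑ i, P.β (pos i) * inner ℝ (T (tr i)) (π i ω : Vec d)) ∂μ|
      ≤ (∏ i, P.α (pos i) / meanPartition P s (pos i))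
        * (((8 * Real.exp (b ^ 2 / 2)) ^ (2 * N) * D + 2) * (δ + noiseWeight P)) := by
  have hK : 1 ≤ Real.exp (b ^ 2 / 2) := Real.one_le_exp (by positivity)
  have hw0 := noiseWeight_nonneg P
  have hw1 := noiseWeight_le P
  have ha : ∀ i, 0 ≤ P.α (pos i) / meanPartition P s (pos i) := fun i =>
    div_nonneg (P.α_pos _).le
      ((Nat.cast_nonneg m).trans (natCast_le_meanPartition P s (pos i)))
  have ha' := Finset.prod_nonneg fun i (_ : i ∈ Finset.univ) => ha i
  have hD0 : 0 ≤ D := (integral_nonneg fun ω => (Real.exp_pos _).le).trans (hD ∅)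
  refine (abs_integral_prod_sub_le (μ := μ) (K := 2 * Real.exp (b ^ 2 / 2)) (η := δ + noiseWeight P)
    (fun i => (continuous_trigramProb P T hm (pos i) (tr i)).measurable.comp (hπ i))
    (fun i ω => (trigramProb_pos P T hm _ _ _).le) (fun i ω => trigramProb_le_one P T hm _ _ _) ha
    (by linarith) (by linarith) (by linarith) hσ
    (MeasurableSet.iUnion fun i => hπ i (measurableSet_atypicalSet P T s δ)) hS ?_ hint hint2 hD
    hD2).trans ?_
  · intro i ω hω
    simp only [Set.mem_iUnion, Set.mem_preimage, not_exists] at hω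
    exact abs_trigramProb_sub_le hm hb hδ hδ0 (hω i) _ _
  · have h1 := one_le_prod_mul_pow hm hb pos hι
    generalize (∏ i, P.α (pos i) / meanPartition P s (pos i)) = A at *
    -- The contribution of atypical products becomes relative to the Gibbs weight here.
    have h2 : σ ^ 2 ≤ A * δ := by
      calc σ ^ 2 ≤ σ ^ 2 * (A * (2 * m * Real.exp (b ^ 2 / 2)) ^ (2 * N)) :=
            le_mul_of_one_le_right (sq_nonneg _) h1
        _ = A * (σ ^ 2 * (2 * m * Real.exp (b ^ 2 / 2)) ^ (2 * N)) := by ring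
        _ ≤ _ := by gcongr
    have h3 : (4 * (2 * Real.exp (b ^ 2 / 2))) ^ Fintype.card ι
        ≤ (8 * Real.exp (b ^ 2 / 2)) ^ (2 * N) := by
      rw [show 4 * (2 * Real.exp (b ^ 2 / 2)) = 8 * Real.exp (b ^ 2 / 2) by ring]
      exact pow_le_pow_right₀ (by linarith) hι
    calc _ ≤ A * ((δ + noiseWeight P) * ((8 * Real.exp (b ^ 2 / 2)) ^ (2 * N) * D) + δ / 2)
          + A * δ := by gcongr
      _ = A * ((8 * Real.exp (b ^ 2 / 2)) ^ (2 * N) * D * (δ + noiseWeight P) + 3 / 2 * δ) := by ring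
      _ ≤ _ := by gcongr; linarith

lemma le_integral_prod_trigramProb (hm : 0 < m)
    (hδ : δ ≤ 1 / 2) (hπ : ∀ i, Measurable (π i)) (hι : Fintype.card ι ≤ 2 * N)
    (hσ : 0 < σ) (hS : μ.real (⋃ i, π i ⁻¹' atypicalSet P T s δ) ≤ σ ^ 2)
    (hint : Integrable
      (fun ω => Real.exp (∑ i, P.β (pos i) * inner ℝ (T (tr i)) (π i ω : Vec d))) μ)
    (hint2 : Integrable
      (fun ω => Real.exp (2 * ∑ i, P.β (pos i) * inner ℝ (T (tr i)) (π i ω : Vec d))) μ)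
    (hD2 : ∫ ω, Real.exp (2 * ∑ i, P.β (pos i) * inner ℝ (T (tr i)) (π i ω : Vec d)) ∂μ ≤ D)
    (hone : 1 ≤ ∫ ω, Real.exp (∑ i, P.β (pos i) * inner ℝ (T (tr i)) (π i ω : Vec d)) ∂μ)
    (hσD : σ * (D + 1) ≤ δ) :
    (∏ i, P.α (pos i) / meanPartition P s (pos i)) * (1 / 2) ^ (2 * N + 1)
      ≤ ∫ ω, ∏ i, trigramProb P T (π i ω) (pos i) (tr i) ∂μ := by
  have ha : ∀ i, 0 ≤ P.α (pos i) / meanPartition P s (pos i) := fun i =>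
    div_nonneg (P.α_pos _).le
      ((Nat.cast_nonneg m).trans (natCast_le_meanPartition P s (pos i)))
  have ha' := Finset.prod_nonneg fun i (_ : i ∈ Finset.univ) => ha i
  refine le_trans ?_ (le_integral_prod (μ := μ) (θ := 1 / 2)
    (fun i => (continuous_trigramProb P T hm (pos i) (tr i)).measurable.comp (hπ i))
    (fun i ω => (trigramProb_pos P T hm _ _ _).le) (fun i ω => trigramProb_le_one P T hm _ _ _) ha
    (by norm_num) hσ (MeasurableSet.iUnion fun i => hπ i (measurableSet_atypicalSet P T s δ)) hS
    (fun i ω hω => ?_) hint hint2 hD2)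
  -- One factor $1/2$ per trigram, and one more because the integral is at least 1 while
  -- $\sigma(D+1)/2\le\delta/2\le1/4$.
  · rw [pow_succ]
    gcongr ?_ * (?_ * ?_)
    · exact pow_le_pow_of_le_one (by norm_num) (by norm_num) hι
    · linarith
  · simp only [Set.mem_iUnion, Set.mem_preimage, not_exists] at hω
    exact le_trigramProb hm hδ (hω i) _ _

end Mixture

end Trigrams

end

/-! ### Probabilities of queries and of adjacent pairs of queries. -/

section

section Queries

variable {N m d : ℕ}

lemma lengthProb_pos (P : Params N) (n : ℕ) : 0 < lengthProb P n := by
  have h := P.rate_pos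
  have h2 : 0 < ∑ k ∈ Finset.range (N + 1), P.rate ^ k / (k.factorial : ℝ) :=
    Finset.sum_pos (fun k _ => by positivity) ⟨0, by simp⟩
  unfold lengthProb
  positivity

/-- A bound, relative to the dimension, for the squared norms of the query vectors. -/
def queryNormBound (N : ℕ) (b : ℝ) : ℝ := 6 * N ^ 2 * b ^ 2

/-- A bound for the exponential moments of the queries. -/
def momentBound (N : ℕ) (b : ℝ) : ℝ := Real.exp (8 * queryNormBound N b)

/-- The relative error caused by the mixtures and by the fluctuations of the partition functions,
per unit of these. -/
def mixtureConst (N : ℕ) (b : ℝ) : ℝ := (8 * Real.exp (b ^ 2 / 2)) ^ (2 * N) * momentBound N b + 2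

lemma queryNormBound_nonneg (N : ℕ) (b : ℝ) : 0 ≤ queryNormBound N b := by
  unfold queryNormBound; positivity

/-- The exponent 8 is the largest that occurs: $2a^2$ with $a=2$ for pairs, and $4\cdot\frac42$ in
the error of the sphere average for the sum of two queries. -/
lemma exp_le_momentBound {N : ℕ} {b a : ℝ} (ha : a ≤ 8) :
    Real.exp (a * queryNormBound N b) ≤ momentBound N b :=
  Real.exp_le_exp.2 (mul_le_mul_of_nonneg_right ha (queryNormBound_nonneg N b))

lemma one_le_momentBound (N : ℕ) (b : ℝ) : 1 ≤ momentBound N b :=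
  Real.one_le_exp (mul_nonneg (by norm_num) (queryNormBound_nonneg N b))

/-- Vocabularies for which the closed forms hold: most partition functions are near their means,
and the trigrams with labels in `L` are not too long. -/
structure IsTypical (P : Params N) (s : Fin m → ℝ) (T : Fin m → Vec d) (L : Finset (Fin m))
    (b δ σ : ℝ) : Prop where
  card_pos : 0 < m
  abs_le : ∀ i t, |P.β i * s t| ≤ b
  δ_nonneg : 0 ≤ δ
  δ_le : δ ≤ 1 / 2
  σ_pos : 0 < σ
  -- The factor 2 serves pairs, either member of which may be atypical.
  atypical_le : 2 * (productLaw d).real (atypicalSet P T s δ) ≤ σ ^ 2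
  norm_sq_le : ∀ t ∈ L, ∀ i, ‖P.β i • T t‖ ^ 2 ≤ 6 * b ^ 2 * d
  σ_mul_le : σ * (momentBound N b + 1) ≤ δ
  σ_sq_mul_le : σ ^ 2 * (2 * m * Real.exp (b ^ 2 / 2)) ^ (2 * N) ≤ δ

/-- The part of the vector of a query that comes from a set of places. -/
def partialVec (P : Params N) (T : Fin m → Vec d) (q : Query N m) (J : Finset (Fin (q.1 : ℕ))) :
    Vec d :=
  ∑ i ∈ J, P.β (position q i) • T (q.2 i)

lemma inner_partialVec (P : Params N) (T : Fin m → Vec d) (q : Query N m)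
    (J : Finset (Fin (q.1 : ℕ))) (p : Vec d) :
    ∑ i ∈ J, P.β (position q i) * inner ℝ (T (q.2 i)) p = inner ℝ (partialVec P T q J) p := by
  simp [partialVec, sum_inner, real_inner_smul_left]

lemma partialVec_univ (P : Params N) (T : Fin m → Vec d) (q : Query N m) :
    partialVec P T q Finset.univ = queryVec P T q := rfl

lemma card_query_le (q : Query N m) : Fintype.card (Fin (q.1 : ℕ)) ≤ N := by
  rw [Fintype.card_fin]; exact Nat.lt_succ_iff.1 q.1.isLt

/-- The Gibbs weight of a query. -/
def gibbsWeight (P : Params N) (s : Fin m → ℝ) (q : Query N m) : ℝ :=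
  ∏ i, P.α (position q i) / meanPartition P s (position q i)

variable {P : Params N} {s : Fin m → ℝ} {T : Fin m → Vec d} {L : Finset (Fin m)} {b δ σ : ℝ}

lemma IsTypical.norm_partialVec_sq_le (h : IsTypical P s T L b δ σ) {q : Query N m}
    (hq : ∀ i, q.2 i ∈ L) (J : Finset (Fin (q.1 : ℕ))) :
    ‖partialVec P T q J‖ ^ 2 ≤ queryNormBound N b * d := by
  have h1 : ∀ i, ‖P.β (position q i) • T (q.2 i)‖ ≤ √(6 * b ^ 2 * d) := fun i =>
    Real.le_sqrt_of_sq_le (h.norm_sq_le _ (hq i) _)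
  have h2 : ‖partialVec P T q J‖ ≤ N * √(6 * b ^ 2 * d) := by
    calc _ ≤ ∑ i ∈ J, ‖P.β (position q i) • T (q.2 i)‖ := norm_sum_le _ _
      _ ≤ ∑ i ∈ J, √(6 * b ^ 2 * d) := Finset.sum_le_sum fun i _ => h1 i
      _ = J.card * √(6 * b ^ 2 * d) := by simp
      _ ≤ _ := by
        gcongr
        exact J.card_le_univ.trans (card_query_le q)
  calc _ ≤ (N * √(6 * b ^ 2 * d)) ^ 2 := by gcongr
    _ = _ := by
      rw [mul_pow, Real.sq_sqrt (by positivity), queryNormBound]; ring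

lemma gibbsWeight_pos (hm : 0 < m) (q : Query N m) : 0 < gibbsWeight P s q := by
  refine Finset.prod_pos fun i _ => div_pos (P.α_pos _) (lt_of_lt_of_le ?_
    (natCast_le_meanPartition P s _))
  exact_mod_cast hm

lemma queryProbApprox_eq (q : Query N m) : queryProbApprox P s T q
    = lengthProb P q.1 * gibbsWeight P s q * Real.exp (‖queryVec P T q‖ ^ 2 / (2 * d)) := rfl

lemma cooccurProbApprox_eq (q q' : Query N m) : cooccurProbApprox P s T q q'
    = lengthProb P q.1 * gibbsWeight P s q * (lengthProb P q'.1 * gibbsWeight P s q')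
      * Real.exp (‖queryVec P T q + queryVec P T q'‖ ^ 2 / (2 * d)) := rfl

lemma sum_sum_eq_inner (q q' : Query N m) (J : Finset (Fin (q.1 : ℕ) ⊕ Fin (q'.1 : ℕ)))
    (x : Product d × Product d) :
    ∑ i ∈ J, P.β (Sum.elim (position q) (position q') i)
        * inner ℝ (T (Sum.elim q.2 q'.2 i))
          (Sum.elim (fun _ => Prod.fst) (fun _ => Prod.snd) i x : Product d).1
      = inner ℝ (partialVec P T q J.toLeft) (x.1 : Vec d)
        + inner ℝ (partialVec P T q' J.toRight) (x.2 : Vec d) := by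
  rw [← inner_partialVec, ← inner_partialVec]
  conv_lhs => rw [← Finset.toLeft_disjSum_toRight (u := J), Finset.sum_disjSum]
  rfl

variable [NeZero d]

lemma div_two_mul_le {x y : ℝ} (h : x ≤ y * d) : x / (2 * d) ≤ 1 / 2 * y := by
  have hd : (0 : ℝ) < d := by exact_mod_cast NeZero.pos d
  rw [div_le_iff₀ (by positivity)]
  linarith

/-- The sphere average of the exponential of a short vector. -/
lemma abs_integral_exp_inner_sub_le {v : Vec d} {a : ℝ} (ha : a ≤ 4)
    (hv : ‖v‖ ^ 2 ≤ (a * queryNormBound N b) * d) :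
    |∫ p : Product d, Real.exp (inner ℝ v (p : Vec d)) ∂(productLaw d)
      - Real.exp (‖v‖ ^ 2 / (2 * d))| ≤ momentBound N b / d := by
  have h1 := integral_exp_inner_le v
  have h2 := le_integral_exp_inner v
  have h3 : Real.exp (4 * (‖v‖ ^ 2 / (2 * d))) / d ≤ momentBound N b / d := by
    have := div_two_mul_le hv
    have := mul_le_mul_of_nonneg_right ha (queryNormBound_nonneg N b)
    exact div_le_div_of_nonneg_right (Real.exp_le_exp.2 (by linarith)) (Nat.cast_nonneg d)
  have h4 : 0 ≤ momentBound N b / d := by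
    have := one_le_momentBound N b
    positivity
  rw [abs_le]
  constructor <;> linarith

/-- The intermediate quantity is the Gibbs weight times $\mathbb E\,e^{\langle q,p\rangle}$: the
mixtures account for one error and the sphere average for the other. -/
lemma IsTypical.queryProb_bounds (h : IsTypical P s T L b δ σ) {q : Query N m}
    (hq : ∀ i, q.2 i ∈ L) :
    |queryProb P T q - queryProbApprox P s T q|
      ≤ (mixtureConst N b * (δ + noiseWeight P) + momentBound N b / d) * queryProbApprox P s T q ∧
    (1 / 2) ^ (2 * N + 1) / momentBound N b * queryProbApprox P s T q ≤ queryProb P T q := by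
  have hd : (0 : ℝ) < d := by exact_mod_cast NeZero.pos d
  have hD1 := one_le_momentBound N b
  have hS : (productLaw d).real (⋃ _i : Fin (q.1 : ℕ), id ⁻¹' atypicalSet P T s δ) ≤ σ ^ 2 := by
    refine (measureReal_mono (Set.iUnion_subset fun _ => subset_rfl)).trans ?_
    have := h.atypical_le
    have : 0 ≤ (productLaw d).real (atypicalSet P T s δ) := measureReal_nonneg
    simp only [Set.preimage_id_eq, id]
    linarith
  have hι : Fintype.card (Fin (q.1 : ℕ)) ≤ 2 * N := (card_query_le q).trans (by omega)
  have hexp : ∀ (a : ℝ) (_ : a ^ 2 / 2 ≤ 8) (J : Finset (Fin (q.1 : ℕ))),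
      ∫ p : Product d, Real.exp (a * inner ℝ (partialVec P T q J) (p : Vec d)) ∂(productLaw d)
        ≤ momentBound N b := fun a ha J => by
    refine (integral_exp_inner_le_of_sq_le (h.norm_partialVec_sq_le hq J) a).trans ?_
    rw [mul_div_right_comm]
    exact exp_le_momentBound ha
  have h1 := abs_integral_prod_trigramProb_sub_le (μ := productLaw d) (π := fun _ => id)
    (pos := position q) (tr := q.2) (T := T) (s := s) (D := momentBound N b) h.card_pos h.abs_le h.δ_le h.δ_nonneg
    (fun _ => measurable_id) hι h.σ_pos hS
    (fun J => integrable_of_continuous (by simp only [id]; fun_prop))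
    (integrable_of_continuous (by simp only [id]; fun_prop))
    (fun J => by
      simp only [id, inner_partialVec]
      simpa using hexp 1 (by norm_num) J)
    (by
      simp only [id, inner_partialVec]
      exact hexp 2 (by norm_num) Finset.univ) h.σ_mul_le h.σ_sq_mul_le
  have hone : 1 ≤ ∫ p : Product d, Real.exp (∑ i, P.β (position q i)
      * inner ℝ (T (q.2 i)) (id p : Vec d)) ∂(productLaw d) := by
    simp only [id, inner_partialVec]
    exact one_le_integral_exp _
  have h2 := le_integral_prod_trigramProb (μ := productLaw d) (π := fun _ => id)
    (pos := position q) (tr := q.2) (T := T) (s := s) (D := momentBound N b) h.card_pos h.δ_le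
    (fun _ => measurable_id) hι h.σ_pos hS
    (integrable_of_continuous (by simp only [id]; fun_prop))
    (integrable_of_continuous (by simp only [id]; fun_prop))
    (by
      simp only [id, inner_partialVec]
      exact hexp 2 (by norm_num) Finset.univ) hone h.σ_mul_le
  have h3 := abs_integral_exp_inner_sub_le (a := 1) (b := b) (N := N) (by norm_num)
    (by simpa using h.norm_partialVec_sq_le hq Finset.univ)
  simp only [id, inner_partialVec] at h1 h2
  rw [partialVec_univ] at h1 h3
  have hQ : queryProb P T q = lengthProb P q.1
      * ∫ p, ∏ i, trigramProb P T p (position q i) (q.2 i) ∂(productLaw d) := by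
    rw [← integral_const_mul]; rfl
  have hl := lengthProb_pos P q.1
  have hg : 0 < gibbsWeight P s q := gibbsWeight_pos h.card_pos q
  change |_ - gibbsWeight P s q * _| ≤ gibbsWeight P s q * (mixtureConst N b * _) at h1
  change gibbsWeight P s q * _ ≤ _ at h2
  rw [hQ, queryProbApprox_eq]
  -- The exponential lies between 1 and `momentBound`: the lower bound makes the errors relative to
  -- the closed form, the upper one converts the floor.
  have hE1 : 1 ≤ Real.exp (‖queryVec P T q‖ ^ 2 / (2 * d)) := Real.one_le_exp (by positivity)
  have hE2 : Real.exp (‖queryVec P T q‖ ^ 2 / (2 * d)) ≤ momentBound N b := by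
    refine le_trans (Real.exp_le_exp.2 ?_) (exp_le_momentBound (a := 1 / 2) (by norm_num))
    exact div_two_mul_le (h.norm_partialVec_sq_le hq Finset.univ)
  have hmix : 0 ≤ mixtureConst N b * (δ + noiseWeight P) + momentBound N b / d := by
    have := noiseWeight_nonneg P
    have := h.δ_nonneg
    unfold mixtureConst
    positivity
  generalize ∫ p, ∏ i, trigramProb P T p (position q i) (q.2 i) ∂(productLaw d) = I at *
  generalize ∫ p : Product d, Real.exp (inner ℝ (queryVec P T q) (p : Vec d)) ∂(productLaw d) = F
    at *
  generalize Real.exp (‖queryVec P T q‖ ^ 2 / (2 * d)) = E at *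
  generalize gibbsWeight P s q = g at *
  generalize lengthProb P q.1 = l at *
  constructor
  · calc |l * I - l * g * E| = l * |(I - g * F) + g * (F - E)| := by
          rw [← abs_of_pos hl, ← abs_mul, abs_of_pos hl]; ring_nf
      _ ≤ l * (g * (mixtureConst N b * (δ + noiseWeight P)) + g * (momentBound N b / d)) := by
          gcongr
          refine (abs_add_le _ _).trans (add_le_add h1 ?_)
          rw [abs_mul, abs_of_pos hg]
          gcongr
      _ = (mixtureConst N b * (δ + noiseWeight P) + momentBound N b / d) * (l * g * 1) := by ring
      _ ≤ _ := by gcongr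
  · calc (1 / 2) ^ (2 * N + 1) / momentBound N b * (l * g * E)
        ≤ (1 / 2) ^ (2 * N + 1) / momentBound N b * (l * g * momentBound N b) := by gcongr
      _ = l * (g * (1 / 2) ^ (2 * N + 1)) := by field_simp
      _ ≤ _ := by gcongr

/-- The places of both queries are indexed by a sum type, each reading its own coordinate of the
pair, so that the mixture estimates apply at once. Two further comparisons remain: one product in
place of two (the radius), then the sphere average at $q+q'$. -/
lemma IsTypical.cooccurProb_bounds (h : IsTypical P s T L b δ σ) {q q' : Query N m}
    (hq : ∀ i, q.2 i ∈ L) (hq' : ∀ i, q'.2 i ∈ L) :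
    |cooccurProb P T q q' - cooccurProbApprox P s T q q'|
      ≤ (mixtureConst N b * (δ + noiseWeight P) + momentBound N b / d
          + 5 * momentBound N b * P.radius) * cooccurProbApprox P s T q q' ∧
    (1 / 2) ^ (2 * N + 1) / momentBound N b * cooccurProbApprox P s T q q'
      ≤ cooccurProb P T q q' := by
  have hd : (0 : ℝ) < d := by exact_mod_cast NeZero.pos d
  have hD1 := one_le_momentBound N b
  have hr := P.radius_pos
  have := isProbabilityMeasure_adjacentProductLaw (d := d) hr
  set π : Fin (q.1 : ℕ) ⊕ Fin (q'.1 : ℕ) → Product d × Product d → Product d :=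
    Sum.elim (fun _ => Prod.fst) (fun _ => Prod.snd) with hπdef
  have hπ : ∀ i, Measurable (π i) := by
    rintro (i | i)
    · exact measurable_fst
    · exact measurable_snd
  have hπc : ∀ i, Continuous (π i) := by
    rintro (i | i)
    · exact continuous_fst
    · exact continuous_snd
  have hS : (adjacentProductLaw d P.radius).real (⋃ i, π i ⁻¹' atypicalSet P T s δ) ≤ σ ^ 2 := by
    have hA := measurableSet_atypicalSet P T s δ
    have e1 := (measurePreserving_fst_adjacent (d := d) hr).measureReal_preimage hA.nullMeasurableSet
    have e2 := (measurePreserving_snd_adjacent (d := d) hr).measureReal_preimage hA.nullMeasurableSet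
    calc _ ≤ (adjacentProductLaw d P.radius).real
          (Prod.fst ⁻¹' atypicalSet P T s δ ∪ Prod.snd ⁻¹' atypicalSet P T s δ) := by
          refine measureReal_mono (Set.iUnion_subset ?_)
          rintro (i | i)
          · exact Set.subset_union_left
          · exact Set.subset_union_right
      _ ≤ _ := measureReal_union_le _ _
      _ = 2 * (productLaw d).real (atypicalSet P T s δ) := by rw [e1, e2]; ring
      _ ≤ _ := h.atypical_le
  have hι : Fintype.card (Fin (q.1 : ℕ) ⊕ Fin (q'.1 : ℕ)) ≤ 2 * N := by
    rw [Fintype.card_sum]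
    have := card_query_le q
    have := card_query_le q'
    omega
  have hexp : ∀ (a : ℝ) (_ : 2 * a ^ 2 ≤ 8) (J : Finset (Fin (q.1 : ℕ) ⊕ Fin (q'.1 : ℕ))),
      ∫ x, Real.exp (a * (inner ℝ (partialVec P T q J.toLeft) (x.1 : Vec d)
        + inner ℝ (partialVec P T q' J.toRight) (x.2 : Vec d))) ∂(adjacentProductLaw d P.radius)
        ≤ momentBound N b := fun a ha J =>
    (integral_exp_adjacent_le hr (h.norm_partialVec_sq_le hq _)
      (h.norm_partialVec_sq_le hq' _) a).trans (exp_le_momentBound ha)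
  have hint : ∀ J : Finset (Fin (q.1 : ℕ) ⊕ Fin (q'.1 : ℕ)), Integrable
      (fun x => Real.exp (∑ i ∈ J, P.β (Sum.elim (position q) (position q') i)
        * inner ℝ (T (Sum.elim q.2 q'.2 i)) (π i x : Vec d))) (adjacentProductLaw d P.radius) :=
    fun J => integrable_of_continuous (by fun_prop)
  have hint2 : Integrable
      (fun x => Real.exp (2 * ∑ i, P.β (Sum.elim (position q) (position q') i)
        * inner ℝ (T (Sum.elim q.2 q'.2 i)) (π i x : Vec d))) (adjacentProductLaw d P.radius) :=
    integrable_of_continuous (by fun_prop)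
  have hD2 : ∫ x, Real.exp (2 * ∑ i, P.β (Sum.elim (position q) (position q') i)
        * inner ℝ (T (Sum.elim q.2 q'.2 i)) (π i x : Vec d)) ∂(adjacentProductLaw d P.radius)
        ≤ momentBound N b := by
    simp only [hπdef, sum_sum_eq_inner]
    exact hexp 2 (by norm_num) Finset.univ
  have h1 := abs_integral_prod_trigramProb_sub_le (μ := adjacentProductLaw d P.radius) (π := π)
    (pos := Sum.elim (position q) (position q')) (tr := Sum.elim q.2 q'.2) (T := T) (s := s)
    (D := momentBound N b) h.card_pos h.abs_le h.δ_le h.δ_nonneg hπ hι h.σ_pos hS hint hint2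
    (fun J => by
      simp only [hπdef, sum_sum_eq_inner]
      simpa using hexp 1 (by norm_num) J) hD2 h.σ_mul_le h.σ_sq_mul_le
  have hone : 1 ≤ ∫ x, Real.exp (∑ i, P.β (Sum.elim (position q) (position q') i)
        * inner ℝ (T (Sum.elim q.2 q'.2 i)) (π i x : Vec d)) ∂(adjacentProductLaw d P.radius) := by
    simp only [hπdef, sum_sum_eq_inner]
    exact one_le_integral_exp_adjacent hr _ _
  have h2 := le_integral_prod_trigramProb (μ := adjacentProductLaw d P.radius) (π := π)
    (pos := Sum.elim (position q) (position q')) (tr := Sum.elim q.2 q'.2) (T := T) (s := s)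
    (D := momentBound N b) h.card_pos h.δ_le hπ hι h.σ_pos hS (hint _) hint2 hD2 hone h.σ_mul_le
  have hv := h.norm_partialVec_sq_le hq Finset.univ
  have hw := h.norm_partialVec_sq_le hq' Finset.univ
  rw [partialVec_univ] at hv hw
  have hvw : ‖queryVec P T q + queryVec P T q'‖ ^ 2 ≤ (4 * queryNormBound N b) * d := by
    have : ‖queryVec P T q + queryVec P T q'‖ ^ 2 ≤ (‖queryVec P T q‖ + ‖queryVec P T q'‖) ^ 2 := by
      gcongr; exact norm_add_le _ _
    nlinarith [sq_nonneg (‖queryVec P T q‖ - ‖queryVec P T q'‖)]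
  have h3 := abs_integral_exp_inner_sub_le (a := 4) (b := b) (N := N) le_rfl hvw
  have h4 := abs_integral_exp_adjacent_sub_le hr hv hw
  have h5 : P.radius * (queryNormBound N b + 4 * Real.exp (8 * queryNormBound N b))
      ≤ 5 * momentBound N b * P.radius := by
    have : queryNormBound N b ≤ momentBound N b := by
      have := Real.add_one_le_exp (8 * queryNormBound N b)
      have := queryNormBound_nonneg N b
      unfold momentBound
      linarith
    change P.radius * (queryNormBound N b + 4 * momentBound N b) ≤ _
    nlinarith
  simp only [hπdef, sum_sum_eq_inner, Fintype.prod_sum_type, Sum.elim_inl, Sum.elim_inr] at h1 h2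
  have hQ : cooccurProb P T q q' = lengthProb P q.1 * lengthProb P q'.1
      * ∫ x, (∏ i, trigramProb P T x.1 (position q i) (q.2 i))
        * ∏ i, trigramProb P T x.2 (position q' i) (q'.2 i) ∂(adjacentProductLaw d P.radius) := by
    rw [← integral_const_mul]
    refine integral_congr_ae (.of_forall fun x => ?_)
    simp only [queryProbGiven]
    ring
  have hl := lengthProb_pos P q.1
  have hl' := lengthProb_pos P q'.1
  have hg : 0 < gibbsWeight P s q := gibbsWeight_pos h.card_pos q
  have hg' : 0 < gibbsWeight P s q' := gibbsWeight_pos h.card_pos q'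
  change |_ - gibbsWeight P s q * gibbsWeight P s q' * _|
    ≤ gibbsWeight P s q * gibbsWeight P s q' * (mixtureConst N b * _) at h1
  change gibbsWeight P s q * gibbsWeight P s q' * _ ≤ _ at h2
  rw [hQ, cooccurProbApprox_eq]
  have hE1 : 1 ≤ Real.exp (‖queryVec P T q + queryVec P T q'‖ ^ 2 / (2 * d)) :=
    Real.one_le_exp (by positivity)
  have hE2 : Real.exp (‖queryVec P T q + queryVec P T q'‖ ^ 2 / (2 * d)) ≤ momentBound N b := by
    refine le_trans (Real.exp_le_exp.2 ?_) (exp_le_momentBound (a := 2) (by norm_num))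
    linarith [div_two_mul_le hvw]
  have hmix : 0 ≤ mixtureConst N b * (δ + noiseWeight P) + momentBound N b / d
      + 5 * momentBound N b * P.radius := by
    have := noiseWeight_nonneg P
    have := h.δ_nonneg
    unfold mixtureConst
    positivity
  have huniv1 : (Finset.univ : Finset (Fin (q.1 : ℕ) ⊕ Fin (q'.1 : ℕ))).toLeft = Finset.univ := by
    ext; simp
  have huniv2 : (Finset.univ : Finset (Fin (q.1 : ℕ) ⊕ Fin (q'.1 : ℕ))).toRight = Finset.univ := by
    ext; simp
  rw [huniv1, huniv2, partialVec_univ, partialVec_univ] at h1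
  have h6 := (abs_sub_le _ _ _).trans (add_le_add (h4.trans h5) h3)
  generalize ∫ x, (∏ i, trigramProb P T x.1 (position q i) (q.2 i))
        * ∏ i, trigramProb P T x.2 (position q' i) (q'.2 i) ∂(adjacentProductLaw d P.radius) = I at *
  generalize ∫ x : Product d × Product d, Real.exp (inner ℝ (queryVec P T q) (x.1 : Vec d)
    + inner ℝ (queryVec P T q') (x.2 : Vec d)) ∂(adjacentProductLaw d P.radius) = F at *
  generalize Real.exp (‖queryVec P T q + queryVec P T q'‖ ^ 2 / (2 * d)) = E at *
  generalize gibbsWeight P s q = g at *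
  generalize lengthProb P q.1 = l at *
  generalize gibbsWeight P s q' = g' at *
  generalize lengthProb P q'.1 = l' at *
  have hll := mul_pos hl hl'
  have hgg := mul_pos hg hg'
  constructor
  · calc |l * l' * I - l * g * (l' * g') * E| = (l * l') * |(I - g * g' * F) + g * g' * (F - E)| := by
          rw [← abs_of_pos hll, ← abs_mul, abs_of_pos hll]; ring_nf
      _ ≤ (l * l') * (g * g' * (mixtureConst N b * (δ + noiseWeight P))
          + g * g' * (5 * momentBound N b * P.radius + momentBound N b / d)) := by
          gcongr
          refine (abs_add_le _ _).trans (add_le_add h1 ?_)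
          rw [abs_mul, abs_of_pos hgg]
          gcongr
      _ = (mixtureConst N b * (δ + noiseWeight P) + momentBound N b / d
          + 5 * momentBound N b * P.radius) * (l * g * (l' * g') * 1) := by ring
      _ ≤ _ := by gcongr
  · calc (1 / 2) ^ (2 * N + 1) / momentBound N b * (l * g * (l' * g') * E)
        ≤ (1 / 2) ^ (2 * N + 1) / momentBound N b * (l * g * (l' * g') * momentBound N b) := by gcongr
      _ = l * l' * (g * g' * (1 / 2) ^ (2 * N + 1)) := by field_simp
      _ ≤ _ := by gcongr

end Queries

end

/-! ### From probabilities to pointwise mutual information. -/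

section

section Information

variable {N m d : ℕ} {P : Params N} {s : Fin m → ℝ} {T : Fin m → Vec d} {L : Finset (Fin m)}
  {b δ σ : ℝ}

/-- Apply $\log x\le x-1$ to $R$ and to $1/R$; the floor `κ` makes the bound hold without assuming
$R$ near 1. -/
lemma abs_log_le_of_le {κ R : ℝ} (hκ : 0 < κ) (hκ1 : κ ≤ 1) (hR : κ ≤ R) :
    |Real.log R| ≤ |R - 1| / κ := by
  have hR0 : 0 < R := hκ.trans_le hR
  have h1 : |R - 1| ≤ |R - 1| / κ := le_div_self (abs_nonneg _) hκ hκ1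
  rw [abs_le']
  constructor
  · exact (Real.log_le_sub_one_of_pos hR0).trans ((le_abs_self _).trans h1)
  · rw [← Real.log_inv]
    refine (Real.log_le_sub_one_of_pos (inv_pos.2 hR0)).trans ?_
    have e : R⁻¹ - 1 = (1 - R) / R := by field_simp
    rw [e]
    refine (div_le_div_of_nonneg_right (le_abs_self (1 - R)) hR0.le).trans ?_
    rw [abs_sub_comm]
    gcongr

lemma abs_log_div_le {κ e x y : ℝ} (hκ : 0 < κ) (hκ1 : κ ≤ 1) (hy : 0 < y) (hxy : κ * y ≤ x)
    (h : |x - y| ≤ e * y) : |Real.log x - Real.log y| ≤ e / κ := by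
  have hx : 0 < x := (mul_pos hκ hy).trans_le hxy
  rw [← Real.log_div hx.ne' hy.ne']
  refine (abs_log_le_of_le hκ hκ1 ((le_div_iff₀ hy).2 hxy)).trans ?_
  gcongr
  rw [div_sub_one hy.ne', abs_div, abs_of_pos hy]
  exact (div_le_iff₀ hy).2 h

lemma queryProbApprox_pos (hm : 0 < m) (q : Query N m) : 0 < queryProbApprox P s T q :=
  mul_pos (mul_pos (lengthProb_pos P _) (gibbsWeight_pos hm q)) (Real.exp_pos _)

/-- Only the cross term of $\|q+q'\|^2$ survives the division defining the PMI. -/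
lemma cooccurProbApprox_eq_mul (q q' : Query N m) : cooccurProbApprox P s T q q'
    = queryProbApprox P s T q * queryProbApprox P s T q' * Real.exp (gramMatrix P T q q') := by
  have e : ‖queryVec P T q + queryVec P T q'‖ ^ 2 / (2 * (d : ℝ))
      = ‖queryVec P T q‖ ^ 2 / (2 * d) + ‖queryVec P T q'‖ ^ 2 / (2 * d)
        + gramMatrix P T q q' := by
    rw [norm_add_sq_real, gramMatrix, Matrix.of_apply]
    -- For $d=0$ every quotient is 0 by convention.
    rcases eq_or_ne (d : ℝ) 0 with h | h
    · simp [h]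
    · field_simp; ring
  rw [cooccurProbApprox_eq, queryProbApprox_eq, queryProbApprox_eq, e, Real.exp_add, Real.exp_add]
  ring

lemma abs_pmi_sub_le (hm : 0 < m) {q q' : Query N m} {κ e₁ e₂ : ℝ} (hκ : 0 < κ) (hκ1 : κ ≤ 1)
    (h1 : |queryProb P T q - queryProbApprox P s T q| ≤ e₁ * queryProbApprox P s T q)
    (h1' : |queryProb P T q' - queryProbApprox P s T q'| ≤ e₁ * queryProbApprox P s T q')
    (h2 : |cooccurProb P T q q' - cooccurProbApprox P s T q q'| ≤ e₂ * cooccurProbApprox P s T q q')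
    (l1 : κ * queryProbApprox P s T q ≤ queryProb P T q)
    (l1' : κ * queryProbApprox P s T q' ≤ queryProb P T q')
    (l2 : κ * cooccurProbApprox P s T q q' ≤ cooccurProb P T q q') :
    |pmi P T q q' - gramMatrix P T q q'| ≤ (e₂ + 2 * e₁) / κ := by
  have p1 : 0 < queryProbApprox P s T q := queryProbApprox_pos hm q
  have p1' : 0 < queryProbApprox P s T q' := queryProbApprox_pos hm q'
  have hA := cooccurProbApprox_eq_mul (P := P) (s := s) (T := T) q q'
  have p2 : 0 < cooccurProbApprox P s T q q' := by rw [hA]; positivity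
  have hx := (mul_pos hκ p1).trans_le l1
  have hx' := (mul_pos hκ p1').trans_le l1'
  have hx2 := (mul_pos hκ p2).trans_le l2
  have b1 := abs_log_div_le hκ hκ1 p1 l1 h1
  have b1' := abs_log_div_le hκ hκ1 p1' l1' h1'
  have b2 := abs_log_div_le hκ hκ1 p2 l2 h2
  have hlog : Real.log (cooccurProbApprox P s T q q') = Real.log (queryProbApprox P s T q)
      + Real.log (queryProbApprox P s T q') + gramMatrix P T q q' := by
    rw [hA, Real.log_mul (mul_pos p1 p1').ne' (Real.exp_pos _).ne', Real.log_mul p1.ne' p1'.ne',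
      Real.log_exp]
  rw [pmi, Real.log_div hx2.ne' (mul_pos hx hx').ne', Real.log_mul hx.ne' hx'.ne']
  rw [hlog] at b2
  rw [add_div, mul_div_assoc]
  rw [abs_le] at *
  constructor <;> linarith [b1.1, b1.2, b1'.1, b1'.2, b2.1, b2.2]

lemma gramMatrix_rank_le (P : Params N) (T : Fin m → Vec d) : (gramMatrix P T).rank ≤ d := by
  let A : Matrix (Query N m) (Fin d) ℝ := Matrix.of fun q j => queryVec P T q j
  have h : gramMatrix P T = A * ((d : ℝ)⁻¹ • A.transpose) := by
    ext q q'
    simp only [gramMatrix, Matrix.of_apply, Matrix.mul_apply, Matrix.smul_apply,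
      Matrix.transpose_apply, A, PiLp.inner_apply, smul_eq_mul, Finset.sum_div]
    refine Finset.sum_congr rfl fun j _ => ?_
    simp only [RCLike.inner_apply, conj_trivial]
    ring
  rw [h]
  exact (Matrix.rank_mul_le_left _ _).trans (A.rank_le_card_width.trans_eq (by simp))

end Information

/-! ### Exceptional vocabularies and the threshold on their size. -/

section Probability

open ProbabilityTheory

variable {N m d : ℕ} {P : Params N} {s : Fin m → ℝ} {b : ℝ}

/-- The relative fluctuation allowed to the partition functions. -/
def fluctuation (m : ℕ) (b : ℝ) : ℝ := (2 * Real.exp (2 * b ^ 2) + 1) * (Real.log m / √m)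

/-- The measure of atypical products that is tolerated. -/
def exceptionalMass (m : ℕ) (b : ℝ) : ℝ := Real.exp (-(Real.log m ^ 2 / (128 * b ^ 2)))

/-- Since $Z_i\ge m$, the absolute threshold of order $\sqrt m\log m$ lies below the relative one.
The tail for a fixed product is the square of `exceptionalMass`, which leaves room for Markov's
inequality. -/
lemma gaussianLaw_mem_atypicalSet_le (p : Product d) (hb : 1 ≤ b) (hβ : ∀ i t, |P.β i * s t| ≤ b)
    (hm0 : 0 < m) (hm : 64 * b ^ 2 ≤ Real.log m) :
    gaussianLaw m d {g | p ∈ atypicalSet P (fun t => s t • g t) s (fluctuation m b)}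
      ≤ ENNReal.ofReal (3 * N * exceptionalMass m b ^ 2) := by
  have hm' : (0 : ℝ) < m := by exact_mod_cast hm0
  have hL : 0 ≤ Real.log m := by nlinarith
  have h1 : ∀ i, gaussianLaw m d {g | fluctuation m b * meanPartition P s i
      ≤ |partition P (fun t => s t • g t) p i - meanPartition P s i|}
      ≤ ENNReal.ofReal (3 * exceptionalMass m b ^ 2) := fun i => by
    have h := measureReal_abs_partition_sub_le (d := d) p (a := fun t => P.β i * s t) hb (hβ i) hm
    have e : exceptionalMass m b ^ 2 = Real.exp (-(Real.log m ^ 2 / (64 * b ^ 2))) := by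
      rw [exceptionalMass, ← Real.exp_nat_mul]
      congr 1
      push_cast
      field_simp
      ring
    rw [e]
    rw [← ofReal_measureReal]
    refine ENNReal.ofReal_le_ofReal ((measureReal_mono ?_).trans h)
    intro g hg
    have hZ := natCast_le_meanPartition P s i
    have hpart : partition P (fun t => s t • g t) p i
        = ∑ t, Real.exp (P.β i * s t * inner ℝ (g t) (p : Vec d)) := by
      unfold partition
      refine Finset.sum_congr rfl fun t _ => ?_
      rw [real_inner_smul_left, mul_assoc]
    simp only [Set.mem_ofPred_eq, hpart] at hg ⊢
    refine le_trans ?_ hg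
    have e2 : (2 * Real.exp (2 * b ^ 2) + 1) * (Real.log m * √m) = fluctuation m b * m := by
      rw [fluctuation, mul_assoc, div_mul_eq_mul_div, mul_div_assoc, Real.div_sqrt]
    rw [e2]
    refine mul_le_mul_of_nonneg_left hZ ?_
    unfold fluctuation
    positivity
  calc _ = gaussianLaw m d (⋃ i, {g | fluctuation m b * meanPartition P s i
      ≤ |partition P (fun t => s t • g t) p i - meanPartition P s i|}) := by
        congr 1; ext g; simp [atypicalSet]
    _ ≤ ∑ i, gaussianLaw m d {g | fluctuation m b * meanPartition P s i
      ≤ |partition P (fun t => s t • g t) p i - meanPartition P s i|} := measure_iUnion_fintype_le _ _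
    _ ≤ ∑ _i : Fin N, ENNReal.ofReal (3 * exceptionalMass m b ^ 2) :=
        Finset.sum_le_sum fun i _ => h1 i
    _ = _ := by
        rw [Finset.sum_const, Finset.card_univ, Fintype.card_fin, nsmul_eq_mul,
          ← ENNReal.ofReal_natCast, ← ENNReal.ofReal_mul (by positivity)]
        congr 1; ring

lemma measurableSet_joint_atypical (P : Params N) (s : Fin m → ℝ) (δ : ℝ) :
    MeasurableSet {x : (Fin m → Vec d) × Product d |
      x.2 ∈ atypicalSet P (fun t => s t • x.1 t) s δ} := by
  have : {x : (Fin m → Vec d) × Product d | x.2 ∈ atypicalSet P (fun t => s t • x.1 t) s δ}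
      = ⋃ i, {x | δ * meanPartition P s i
        ≤ |partition P (fun t => s t • x.1 t) x.2 i - meanPartition P s i|} := by
    ext x; simp [atypicalSet]
  rw [this]
  refine MeasurableSet.iUnion fun i => measurableSet_le measurable_const ?_
  unfold partition
  fun_prop

/-- With high probability over the trigrams, few products are atypical. -/
lemma gaussianLaw_exceptionalMass_le [NeZero d] (hb : 1 ≤ b) (hβ : ∀ i t, |P.β i * s t| ≤ b)
    (hm0 : 0 < m) (hm : 64 * b ^ 2 ≤ Real.log m) :
    gaussianLaw m d {g | ENNReal.ofReal (exceptionalMass m b)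
        ≤ productLaw d (atypicalSet P (fun t => s t • g t) s (fluctuation m b))}
      ≤ ENNReal.ofReal (3 * N * exceptionalMass m b) := by
  set E := {x : (Fin m → Vec d) × Product d |
      x.2 ∈ atypicalSet P (fun t => s t • x.1 t) s (fluctuation m b)}
  have hE : MeasurableSet E := measurableSet_joint_atypical P s _
  have hρ : 0 < exceptionalMass m b := Real.exp_pos _
  -- Markov for the mass of atypical products, whose mean is computed by exchanging the integrals;
  -- dividing the squared mass by the mass leaves one power.
  have h1 := meas_ge_le_lintegral_div (μ := gaussianLaw m d)
    (measurable_measure_prodMk_left (ν := productLaw d) hE).aemeasurable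
    (ε := ENNReal.ofReal (exceptionalMass m b)) (ENNReal.ofReal_pos.2 hρ).ne' ENNReal.ofReal_ne_top
  refine h1.trans ?_
  rw [← Measure.prod_apply hE, Measure.prod_apply_symm hE]
  have h2 : ∫⁻ p, gaussianLaw m d ((fun g => (g, p)) ⁻¹' E) ∂(productLaw d)
      ≤ ENNReal.ofReal (3 * N * exceptionalMass m b ^ 2) := by
    calc _ ≤ ∫⁻ _p, ENNReal.ofReal (3 * N * exceptionalMass m b ^ 2) ∂(productLaw d) :=
          lintegral_mono fun p => gaussianLaw_mem_atypicalSet_le p hb hβ hm0 hm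
      _ = _ := by simp
  refine (ENNReal.div_le_div_right h2 _).trans_eq ?_
  rw [← ENNReal.ofReal_div_of_pos hρ]
  congr 1
  field_simp

/-- For large vocabularies all error terms are controlled by the fluctuation. -/
lemma exists_log_threshold (N : ℕ) {b : ℝ} (hb : 1 ≤ b) : ∃ L₀ : ℝ, 0 ≤ L₀ ∧ ∀ m : ℕ, 0 < m →
    L₀ ≤ Real.log m → 64 * b ^ 2 ≤ Real.log m ∧ fluctuation m b ≤ 1 / 2 ∧
      √(2 * exceptionalMass m b) * (momentBound N b + 1) ≤ fluctuation m b ∧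
      2 * exceptionalMass m b * (2 * m * Real.exp (b ^ 2 / 2)) ^ (2 * N) ≤ fluctuation m b := by
  set D := momentBound N b
  have hD : 1 ≤ D := one_le_momentBound N b
  set H := (2 * Real.exp (b ^ 2 / 2)) ^ (2 * N)
  have hH : 0 ≤ H := by positivity
  set V := Real.exp (2 * b ^ 2)
  have hV : 0 < V := Real.exp_pos _
  have hN : (0 : ℝ) ≤ N := Nat.cast_nonneg N
  -- The first summand makes the exceptional mass at most $m^{-(2N+6+H)}$, enough to absorb $m^{2N}$
  -- and the constant $H\le e^{HL}$. The second gives $D+1\le e^{L/2}$, and the third makes the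
  -- fluctuation at most $1/2$.
  refine ⟨128 * b ^ 2 * (2 * N + 6 + H) + 2 * D + 16 * (2 * V + 1), by positivity, ?_⟩
  intro m hm hL
  have hm' : (0 : ℝ) < m := by exact_mod_cast hm
  set L := Real.log m with hLdef
  have hexp : Real.exp L = m := Real.exp_log hm'
  have hsq : √(m : ℝ) = Real.exp (L / 2) := by rw [Real.exp_half, hexp]
  have hb2 : 1 ≤ b ^ 2 := one_le_pow₀ hb
  have hbH : 0 ≤ b ^ 2 * (2 * N + H) := by positivity
  have hL1 : 1 ≤ L := by nlinarith
  have hfl : fluctuation m b = (2 * V + 1) * (L * Real.exp (-(L / 2))) := by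
    rw [fluctuation, hsq, Real.exp_neg, div_eq_mul_inv]
  have hfl1 : Real.exp (-(L / 2)) ≤ fluctuation m b := by
    rw [hfl, ← mul_assoc]
    refine le_mul_of_one_le_left (Real.exp_pos _).le ?_
    nlinarith
  have hquad : (2 * N + 6 + H) * L ≤ L ^ 2 / (128 * b ^ 2) := by
    rw [le_div_iff₀ (by positivity)]
    have : (2 * N + 6 + H) * (128 * b ^ 2) ≤ L := by linarith
    nlinarith
  have hmass : exceptionalMass m b ≤ Real.exp (-((2 * N + 6 + H) * L)) :=
    Real.exp_le_exp.2 (neg_le_neg hquad)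
  have hmass0 : 0 ≤ exceptionalMass m b := (Real.exp_pos _).le
  have h2e : (2 : ℝ) ≤ Real.exp L := by linarith [Real.add_one_le_exp L]
  refine ⟨by nlinarith, ?_, ?_, ?_⟩
  · have hq := Real.quadratic_le_exp_of_nonneg (show 0 ≤ L / 2 by linarith)
    rw [hfl, Real.exp_neg, ← mul_assoc, ← div_eq_mul_inv, div_le_iff₀ (Real.exp_pos _)]
    have : 16 * (2 * V + 1) ≤ L := by nlinarith
    nlinarith
  · have h1 : √(2 * exceptionalMass m b) ≤ Real.exp (-L) := by
      rw [Real.sqrt_le_left (Real.exp_pos _).le, ← Real.exp_nat_mul]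
      calc 2 * exceptionalMass m b ≤ Real.exp L * Real.exp (-((2 * N + 6 + H) * L)) := by gcongr
        _ ≤ _ := by
          rw [← Real.exp_add]
          refine Real.exp_le_exp.2 ?_
          push_cast
          nlinarith [mul_nonneg hN (by linarith : 0 ≤ L), mul_nonneg hH (by linarith : 0 ≤ L)]
    have h2 : D + 1 ≤ Real.exp (L / 2) := by
      have := Real.add_one_le_exp (L / 2)
      nlinarith
    refine le_trans ?_ hfl1
    calc _ ≤ Real.exp (-L) * Real.exp (L / 2) := by gcongr
      _ = _ := by rw [← Real.exp_add]; ring_nf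
  · refine le_trans ?_ hfl1
    have e : (2 * m * Real.exp (b ^ 2 / 2)) ^ (2 * N) = H * Real.exp (2 * N * L) := by
      rw [show 2 * (m : ℝ) * Real.exp (b ^ 2 / 2) = (2 * Real.exp (b ^ 2 / 2)) * m by ring, mul_pow,
        ← hexp, ← Real.exp_nat_mul]
      push_cast
      rfl
    rw [e]
    have hHe : H ≤ Real.exp (H * L) := by nlinarith [Real.add_one_le_exp (H * L)]
    calc _ ≤ Real.exp L * Real.exp (-((2 * N + 6 + H) * L)) * (Real.exp (H * L) * Real.exp (2 * N * L)) := by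
          gcongr
      _ ≤ _ := by
          rw [← Real.exp_add, ← Real.exp_add, ← Real.exp_add]
          refine Real.exp_le_exp.2 ?_
          nlinarith

end Probability

end

/-! ### Assembly. -/

variable {N m d : ℕ} {P : Params N} {s : Fin m → ℝ} {b : ℝ}

lemma isTypical_of_lt [NeZero d] (hm : 0 < m) (hb : ∀ i t, |P.β i * s t| ≤ b)
    (hδ : fluctuation m b ≤ 1 / 2)
    (hσ : √(2 * exceptionalMass m b) * (momentBound N b + 1) ≤ fluctuation m b)
    (hσm : 2 * exceptionalMass m b * (2 * m * Real.exp (b ^ 2 / 2)) ^ (2 * N) ≤ fluctuation m b)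
    {L : Finset (Fin m)} {g : Fin m → Vec d}
    (hg : productLaw d (atypicalSet P (fun t => s t • g t) s (fluctuation m b))
      < ENNReal.ofReal (exceptionalMass m b))
    (hgL : ∀ t ∈ L, ‖g t‖ ^ 2 < 6 * d) :
    IsTypical P s (fun t => s t • g t) L b (fluctuation m b) √(2 * exceptionalMass m b) where
  card_pos := hm
  abs_le := hb
  δ_nonneg := by
    have := Real.log_natCast_nonneg m
    unfold fluctuation
    positivity
  δ_le := hδ
  σ_pos := Real.sqrt_pos.2 (mul_pos two_pos (Real.exp_pos _))
  atypical_le := by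
    have h0 : 0 ≤ exceptionalMass m b := (Real.exp_pos _).le
    rw [Real.sq_sqrt (by positivity)]
    have : (productLaw d).real (atypicalSet P (fun t => s t • g t) s (fluctuation m b))
        ≤ exceptionalMass m b := ENNReal.toReal_le_of_le_ofReal h0 hg.le
    linarith
  norm_sq_le t ht i := by
    have h2 := sq_le_sq' (by linarith [(abs_le.1 (hb i t)).1]) (abs_le.1 (hb i t)).2
    have h3 := (hgL t ht).le
    rw [smul_smul, norm_smul, mul_pow, Real.norm_eq_abs, sq_abs]
    calc (P.β i * s t) ^ 2 * ‖g t‖ ^ 2 ≤ b ^ 2 * (6 * d) := by gcongr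
      _ = _ := by ring
  σ_mul_le := hσ
  σ_sq_mul_le := by rwa [Real.sq_sqrt (by unfold exceptionalMass; positivity)]

end

end AttEST

open AttEST

theorem corollary1 (N : ℕ) (B S : ℝ) :
    ∃ (C c : ℝ) (k : ℕ), 0 < C ∧ 0 < c ∧
      ∀ (d m : ℕ), 0 < d → 0 < m →
      ∀ P : AttEST.Params N, (∀ i, |P.β i| ≤ B) →
      ∀ s : Fin m → ℝ, (∀ t, |s t| ≤ S) →
        (∀ T : Fin m → AttEST.Vec d, (AttEST.gramMatrix P T).rank ≤ d) ∧
        ∀ L : Finset (Fin m),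
          (AttEST.gaussianLaw m d)
            {g | ¬ ∀ q q' : AttEST.Query N m, (∀ i, q.2 i ∈ L) → (∀ j, q'.2 j ∈ L) →
              |AttEST.cooccurProb P (fun t => s t • g t) q q'
                  - AttEST.cooccurProbApprox P s (fun t => s t • g t) q q'|
                ≤ C * AttEST.jointError P k m d
                  * AttEST.cooccurProbApprox P s (fun t => s t • g t) q q' ∧
              |AttEST.queryProb P (fun t => s t • g t) q
                  - AttEST.queryProbApprox P s (fun t => s t • g t) q|
                ≤ C * AttEST.singleError P k m d
                  * AttEST.queryProbApprox P s (fun t => s t • g t) q ∧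
              0 < AttEST.cooccurProb P (fun t => s t • g t) q q' ∧
              0 < AttEST.queryProb P (fun t => s t • g t) q ∧
              |AttEST.pmi P (fun t => s t • g t) q q'
                  - AttEST.gramMatrix P (fun t => s t • g t) q q'|
                ≤ C * (C * AttEST.jointError P k m d + C * AttEST.singleError P k m d)}
          ≤ ENNReal.ofReal
              (C * (Real.exp (-c * Real.log (m : ℝ) ^ 2) + (L.card : ℝ) * Real.exp (-(d : ℝ)))) := by
  -- Absolute values, as `B` and `S` carry no sign; the lower bound 1 keeps the divisions by `b`
  -- harmless.
  set b : ℝ := max (|B| * |S|) 1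
  have hb : 1 ≤ b := le_max_right _ _
  obtain ⟨L₀, hL₀, hthr⟩ := exists_log_threshold N hb
  set D := momentBound N b
  have hD : 1 ≤ D := one_le_momentBound N b
  set K := mixtureConst N b
  have hK : 0 ≤ K := by
    have : 0 ≤ (8 * Real.exp (b ^ 2 / 2)) ^ (2 * N) * D := by positivity
    simp only [K, mixtureConst]
    linarith
  set W := 2 * Real.exp (2 * b ^ 2) + 1
  have hW : 1 ≤ W := by linarith [Real.exp_pos (2 * b ^ 2)]
  set κ : ℝ := (1 / 2) ^ (2 * N + 1) / D
  have hκ : 0 < κ := by positivity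
  have hκ1 : κ ≤ 1 := div_le_one_of_le₀ ((pow_le_one₀ (by norm_num) (by norm_num)).trans hD)
    (by linarith)
  set c : ℝ := 1 / (128 * b ^ 2)
  have hc : 0 < c := by positivity
  -- In order: the relative errors (with `D` for the sphere and `5 * D` for the radius), the PMI,
  -- the failure probability, and a term that makes the probability bound trivial when $\log m<L_0$.
  set C : ℝ := (K * W + 6 * D) + 2 / κ + 3 * N + 1 + Real.exp (c * L₀ ^ 2)
  have hKW : 0 ≤ K * W := by positivity
  have hκ2 : 0 < 2 / κ := by positivity
  have hex : 0 < Real.exp (c * L₀ ^ 2) := Real.exp_pos _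
  have hN : (0 : ℝ) ≤ N := Nat.cast_nonneg N
  have hC : 0 < C := by simp only [C]; positivity
  have hC1 : K * W + 6 * D ≤ C := by simp only [C]; linarith
  have hC2 : 2 / κ ≤ C := by simp only [C]; linarith
  have hC3 : 3 * N + 1 ≤ C := by simp only [C]; linarith
  have hC4 : Real.exp (c * L₀ ^ 2) ≤ C := by simp only [C]; linarith
  refine ⟨C, c, 1, hC, hc, fun d m hd hm P hβ s hs => ⟨gramMatrix_rank_le P, fun L => ?_⟩⟩
  have : NeZero d := ⟨hd.ne'⟩
  have hlog : 0 ≤ Real.log (m : ℝ) := Real.log_natCast_nonneg m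
  rcases lt_or_ge (Real.log (m : ℝ)) L₀ with hmL | hmL
  · refine prob_le_one.trans ?_
    rw [ENNReal.one_le_ofReal]
    have h1 : 1 ≤ C * Real.exp (-c * Real.log (m : ℝ) ^ 2) := by
      calc (1 : ℝ) = Real.exp (c * L₀ ^ 2) * Real.exp (-c * L₀ ^ 2) := by
            rw [← Real.exp_add]; simp
        _ ≤ _ := by
            gcongr ?_ * Real.exp ?_
            rw [neg_mul, neg_mul, neg_le_neg_iff]
            gcongr
    have h2 : 0 ≤ C * ((L.card : ℝ) * Real.exp (-(d : ℝ))) := by positivity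
    linarith
  · obtain ⟨hmb, hδ, hσ, hσm⟩ := hthr m hm hmL
    have hβs : ∀ i t, |P.β i * s t| ≤ b := fun i t => by
      rw [abs_mul]
      refine le_trans ?_ (le_max_left _ _)
      exact mul_le_mul ((hβ i).trans (le_abs_self B)) ((hs t).trans (le_abs_self S))
        (abs_nonneg _) (abs_nonneg _)
    have hmass : exceptionalMass m b = Real.exp (-c * Real.log (m : ℝ) ^ 2) := by
      simp only [exceptionalMass, c]; ring_nf
    have hbound : gaussianLaw m d ({g | ENNReal.ofReal (exceptionalMass m b)
          ≤ productLaw d (atypicalSet P (fun t => s t • g t) s (fluctuation m b))}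
        ∪ {g | ∃ t ∈ L, 6 * d ≤ ‖g t‖ ^ 2})
        ≤ ENNReal.ofReal
          (C * (Real.exp (-c * Real.log (m : ℝ) ^ 2) + (L.card : ℝ) * Real.exp (-(d : ℝ)))) := by
      refine (measure_union_le _ _).trans ((add_le_add
        (gaussianLaw_exceptionalMass_le hb hβs hm hmb) (gaussianLaw_exists_norm_sq_ge_le L)).trans ?_)
      rw [← ENNReal.ofReal_add (by unfold exceptionalMass; positivity) (by positivity), hmass]
      refine ENNReal.ofReal_le_ofReal ?_
      rw [mul_add]
      have h1 : 0 ≤ (L.card : ℝ) * Real.exp (-(d : ℝ)) := by positivity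
      exact add_le_add (mul_le_mul_of_nonneg_right (by linarith) (Real.exp_pos _).le)
        (le_mul_of_one_le_left h1 (by linarith))
    -- Monotonicity holds for outer measure, so the failure event need not be shown measurable.
    refine (measure_mono fun g hg => ?_).trans hbound
    by_contra hcon
    simp only [Set.mem_union, Set.mem_ofPred_eq, not_or, not_exists, not_and, not_le] at hcon
    apply hg
    have hT := isTypical_of_lt hm hβs hδ hσ hσm hcon.1 hcon.2
    have hw := noiseWeight_nonneg P
    have hsingle : K * (fluctuation m b + noiseWeight P) + D / d ≤ C * singleError P 1 m d := by
      have h0 : 0 ≤ Real.log (m : ℝ) / √(m : ℝ) := by positivity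
      have h1 : 0 ≤ 1 / (d : ℝ) := by positivity
      have h2 : 0 ≤ singleError P 1 m d := by
        unfold singleError; rw [pow_one]; exact add_nonneg (add_nonneg h0 h1) hw
      refine le_trans ?_ (mul_le_mul_of_nonneg_right hC1 h2)
      change K * (W * (Real.log m / √m) + noiseWeight P) + D / d
        ≤ (K * W + 6 * D) * (Real.log m ^ 1 / √m + 1 / d + noiseWeight P)
      rw [pow_one, div_eq_mul_one_div D]
      have h3 : K * noiseWeight P ≤ K * W * noiseWeight P :=
        mul_le_mul_of_nonneg_right (le_mul_of_one_le_right hK hW) hw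
      have h4 : 0 ≤ K * W * (1 / (d : ℝ)) := by positivity
      have h5 : 0 ≤ D * (Real.log (m : ℝ) / √(m : ℝ)) := by positivity
      have h6 : 0 ≤ D * noiseWeight P := by positivity
      have h7 : 0 ≤ D * (1 / (d : ℝ)) := by positivity
      nlinarith
    have hjoint : K * (fluctuation m b + noiseWeight P) + D / d + 5 * D * P.radius
        ≤ C * jointError P 1 m d := by
      rw [jointError, mul_add C]
      refine add_le_add hsingle (mul_le_mul_of_nonneg_right ?_ P.radius_pos.le)
      linarith
    intro q q' hq hq'
    obtain ⟨u1, l1⟩ := hT.queryProb_bounds hq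
    obtain ⟨u1', l1'⟩ := hT.queryProb_bounds hq'
    obtain ⟨u2, l2⟩ := hT.cooccurProb_bounds hq hq'
    set T : Fin m → Vec d := fun t => s t • g t
    have p1 : 0 < queryProbApprox P s T q := queryProbApprox_pos hm q
    have p1' : 0 < queryProbApprox P s T q' := queryProbApprox_pos hm q'
    have p2 : 0 < cooccurProbApprox P s T q q' := by
      rw [cooccurProbApprox_eq_mul]; positivity
    have v1 := u1.trans (mul_le_mul_of_nonneg_right hsingle p1.le)
    have v1' := u1'.trans (mul_le_mul_of_nonneg_right hsingle p1'.le)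
    have v2 := u2.trans (mul_le_mul_of_nonneg_right hjoint p2.le)
    refine ⟨v2, v1, (mul_pos hκ p2).trans_le l2, (mul_pos hκ p1).trans_le l1, ?_⟩
    refine (abs_pmi_sub_le hm hκ hκ1 v1 v1' v2 l1 l1' l2).trans ?_
    have e1 : 0 ≤ C * singleError P 1 m d :=
      nonneg_of_mul_nonneg_left ((abs_nonneg _).trans v1) p1
    have e2 : 0 ≤ C * jointError P 1 m d :=
      nonneg_of_mul_nonneg_left ((abs_nonneg _).trans v2) p2
    generalize C * singleError P 1 m d = x at *
    generalize C * jointError P 1 m d = y at *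
    calc (y + 2 * x) / κ = 2 / κ * (y / 2 + x) := by field_simp
      _ ≤ C * (y + x) := by gcongr; linarith
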